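/- \textbf{Setting.} Consider $\dot x=f(x)+g(x)u+w(t)$, $x(0)=x_0\in\mathbb R^n$, $u\in\mathbb R^m$, with $f,g$ locally Lipschitz, $w:\mathbb R_{\ge0}\to\mathcal W$ piecewise continuous with $\mathcal W\subset\mathbb R^n$ bounded, and $\lambda_{\min}\|z\|^2\le z^Tg(x)g(x)^Tz$ for all $x,z$ and some $\lambda_{\min}>0$. Let $\psi$ be generated by $\psi::=\top\mid\mu\mid\neg\mu\mid\psi_1\wedge\psi_2$, where a predicate $\mu$ is true at $x$ iff $h(x)\ge0$ for a continuously differentiable $h:\mathbb R^n\to\mathbb R$. For fixed $\eta>0$ its robustness is given by $\rho^{\top}=+\infty$, $\rho^\mu=h$, $\rho^{\neg\mu}=-h$, $\rho^{\psi_1\wedge\psi_2}=-\frac1\eta\ln(e^{-\eta\rho^{\psi_1}}+e^{-\eta\rho^{\psi_2}})$. Let $\phi=G_{[a,b]}\psi$ or $\phi=F_{[a,b]}\psi$ with $0\le a\le b\le\infty$, $a<\infty$, so that $\rho^\phi(x,0)$ is the infimum, respectively the supremum, of $\rho^\psi(x(t))$ over $t\in[a,b]$. Assume that $\rho^\psi$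 is concave, that $\rho^\psi(x)>0$ implies $\|x\|\le C$ for some $C<\infty$, and that $\rho^\psi_{opt}:=\sup_x\rho^\psi(x)>0$. \textbf{Parameters.} Choose $t_*=a$ if $\phi=G_{[a,b]}\psi$ and $t_*\in[a,b]$ if $\phi=F_{[a,b]}\psi$; $\chi>0$; $\rho_{max}\in(\max(0,\rho^\psi(x_0)),\rho^\psi_{opt}-\chi]$; $r\in(0,\rho_{max})$; $\gamma_0>\rho_{max}-\rho^\psi(x_0)$, where if $t_*=0$ also $\gamma_0\le\rho_{max}-r$ and $\rho^\psi(x_0)>r$; $\gamma_\infty\in(0,\min(\gamma_0,\rho_{max}-r)]$; $l\ge0$ arbitrary if $\rho_{max}-\gamma_0\ge r$, and otherwise $\gamma_\infty<\rho_{max}-r$ and $l=-\frac1{t_*}\ln\frac{r+\gamma_\infty-\rho_{max}}{-(\gamma_0-\gamma_\infty)}$. Put $\gamma(t)=(\gamma_0-\gamma_\infty)e^{-lt}+\gamma_\infty$, $\xi(x,t)=(\rho^\psi(x)-\rho_{max})/\gamma(t)$, $\epsilon(x,t)=\ln\bigl(-\frac{\xi(x,t)+1}{\xi(x,t)}\bigr)$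 and $u(x,t)=-\epsilon(x,t)\,g(x)^T\frac{\partial\rho^\psi}{\partial x}(x)$. Let $\Omega_x=\{x:-1<\xi(x,0)<0\}$. Call $k_1,k_2,k_3>0$ \emph{admissible} if for all $x\in\Omega_x$, $v\in\mathcal W$, $\xi\in(-1,0)$, $s\ge0$: $\bigl|\frac{\partial\rho^\psi}{\partial x}(x)^T(f(x)+v)-\xi\dot\gamma(s)\bigr|\le k_1$, $\;\lambda_{\min}\bigl\|\frac{\partial\rho^\psi}{\partial x}(x)\bigr\|^2\ge k_2$, and the sum of the absolute values of the entries of the row vector $\frac{\partial\rho^\psi}{\partial x}(x)^Tg(x)$ is at most $k_3$. \textbf{Closed loop.} Let $0=t_0<t_1<\cdots$ be any triggering instants (finitely or infinitely many; a missing next instant counts as $\infty$), and let $\hat u(t)=u(x(t_i),t_i)$ for $t\in[t_i,t_{i+1})$. A solution on $[0,T)$, $0<T\le\sup_it_i$, is a continuous $x$ with $x(t)=x_0+\int_0^t(f(x)+g(x)\hat u+w)\,ds$ there; it is maximal if it cannot be continued beyond $T$ for the same instants. \textbf{Theorem 2.} Admissible constants $k_1,k_2,k_3$ exist, and for any triggering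 instants the closed loop has a maximal solution. Let $\delta_u>0$ be arbitrary, and let $x$ be a solution on $[0,T)$ with $\|u(x(t),t)-\hat u(t)\|_\infty\le\delta_u$ for all $t\in[0,T)$. Then, for all $t\in[0,T)$, $-1<\xi(x(t),t)<0$ and, for all admissible $k_1,k_2,k_3$, $$|\epsilon(x(t),t)|\le\max\Bigl(|\epsilon(x_0,0)|,\frac{k_1+k_3\delta_u}{k_2}\Bigr).$$ If moreover $x$ is maximal, then $T=\sup_it_i$, i.e. the solution reaches every triggering instant. There is no Zeno behaviour, i.e. $\sup_it_i=\infty$, if the instants obey the rule $t_{i+1}=\inf\{t>t_i:\|x(t)-x(t_i)\|_\infty>\delta_i\text{ or }t-t_i>\delta_i\}$ with thresholds $\delta_i>0$ satisfying $\sum_i\delta_i=\infty$ (for example, bounded below by a positive constant). Whenever there is no Zeno behaviour, a maximal solution is complete, $T=\infty$, and $0<r\le\rho^\phi(x,0)\le\rho_{max}$; in particular $(x,0)\models\phi$, i.e. $\psi$ holds at $x(t)$ for all (if $\phi=G_{[a,b]}\psi$), respectively some (if $\phi=F_{[a,b]}\psi$), $t\in[a,b]$. -/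

import Mathlib

noncomputable section

open scoped Matrix

namespace STLControl

/-- The state space `ℝⁿ` with its Euclidean norm. -/
abbrev State (n : ℕ) : Type := EuclideanSpace ℝ (Fin n)

/-! ### The plant `ẋ = f(x) + g(x) u + w` -/

/-- The vector fields of the plant. Inputs live in `Fin m → ℝ`, whose norm is the maximum norm. -/
structure Plant (n m : ℕ) where
  f : State n → State n
  g : State n → Matrix (Fin n) (Fin m) ℝ

/-- `f` and `g` are locally Lipschitz and `lam ‖z‖² ≤ zᵀ g(x) g(x)ᵀ z` for all `x, z`, `lam > 0`. -/
structure Plant.IsRegular {n m : ℕ} (P : Plant n m) (lam : ℝ) : Prop where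
  lipschitz_f : LocallyLipschitz P.f
  lipschitz_g : ∀ i j, LocallyLipschitz fun x => P.g x i j
  lam_pos : 0 < lam
  posDef : ∀ x z : State n, lam * ‖z‖ ^ 2 ≤ z.ofLp ⬝ᵥ ((P.g x * (P.g x)ᵀ) *ᵥ z.ofLp)

/-- Piecewise continuity on `[0, ∞)`: finitely many discontinuities on every bounded interval, and
finite one-sided limits everywhere. -/
structure PiecewiseContinuous {n : ℕ} (w : ℝ → State n) : Prop where
  finite_disc : ∀ b : ℝ,
    {s : ℝ | 0 ≤ s ∧ s ≤ b ∧ ¬ ContinuousWithinAt w (Set.Ici 0) s}.Finite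
  right_limit : ∀ s : ℝ, 0 ≤ s → ∃ v, Filter.Tendsto w (nhdsWithin s (Set.Ioi s)) (nhds v)
  left_limit : ∀ s : ℝ, 0 < s → ∃ v, Filter.Tendsto w (nhdsWithin s (Set.Iio s)) (nhds v)

/-! ### Signal temporal logic -/

/-- A predicate `μ`, true at `x` iff `h x ≥ 0`, with a continuously differentiable `h`. -/
structure Predicate (n : ℕ) where
  h : State n → ℝ
  contDiff_h : ContDiff ℝ 1 h

/-- Non-temporal formulas `ψ ::= ⊤ | μ | ¬μ | ψ₁ ∧ ψ₂`. -/
inductive NonTemporal (n : ℕ) : Type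
  | top : NonTemporal n
  | pred (μ : Predicate n) : NonTemporal n
  | neg (μ : Predicate n) : NonTemporal n
  | and (ψ₁ ψ₂ : NonTemporal n) : NonTemporal n

/-- Boolean semantics of a non-temporal formula at a state. -/
def NonTemporal.Sat {n : ℕ} : NonTemporal n → State n → Prop
  | .top, _ => True
  | .pred μ, x => 0 ≤ μ.h x
  | .neg μ, x => ¬ 0 ≤ μ.h x
  | .and ψ₁ ψ₂, x => ψ₁.Sat x ∧ ψ₂.Sat x

/-- The smooth under-approximation `-(1/η) ln (exp (-η a) + exp (-η b))` of `min a b`. -/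
def softMin (η : ℝ) (a b : EReal) : EReal :=
  ((-(1 / η) : ℝ) : EReal) *
    ENNReal.log (EReal.exp (((-η : ℝ) : EReal) * a) + EReal.exp (((-η : ℝ) : EReal) * b))

/-- Robust semantics `ρ^ψ(x)`, conjunctions being smoothed with accuracy `η`. The formula `⊤` has
robustness `+∞`, which is the neutral element of `softMin`. -/
def NonTemporal.rob {n : ℕ} (η : ℝ) : NonTemporal n → State n → EReal
  | .top, _ => ⊤
  | .pred μ, x => (μ.h x : EReal)
  | .neg μ, x => ((-μ.h x : ℝ) : EReal)
  | .and ψ₁ ψ₂, x => softMin η (ψ₁.rob η x) (ψ₂.rob η x)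

/-- `ρ^ψ` as a real-valued function (it is real-valued as soon as `ψ` contains a predicate). -/
def NonTemporal.robR {n : ℕ} (η : ℝ) (ψ : NonTemporal n) (x : State n) : ℝ :=
  (ψ.rob η x).toReal

/-- The global optimum `sup_x ρ^ψ(x)`. -/
def NonTemporal.robOpt {n : ℕ} (η : ℝ) (ψ : NonTemporal n) : EReal := ⨆ x, ψ.rob η x

/-- Well-posedness: `ρ^ψ(x) > 0` implies `‖x‖ ≤ C` for some finite `C`. -/
def NonTemporal.WellPosed {n : ℕ} (η : ℝ) (ψ : NonTemporal n) : Prop :=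
  ∃ C : ℝ, ∀ x, 0 < ψ.rob η x → ‖x‖ ≤ C

/-- A time interval `[a, b]` with `0 ≤ a ≤ b ≤ ∞`, `a` finite (for `b = ∞` it is `[a, ∞)`). -/
structure TimeInterval where
  a : ℝ
  b : EReal
  a_nonneg : 0 ≤ a
  a_le_b : (a : EReal) ≤ b

/-- The shifted interval `[t + a, t + b]`, as a set of real times. -/
def TimeInterval.window (I : TimeInterval) (t : ℝ) : Set ℝ :=
  {s : ℝ | t + I.a ≤ s ∧ (s : EReal) ≤ (t : EReal) + I.b}

/-- Temporal formulas `φ ::= G_[a,b] ψ | F_[a,b] ψ`. -/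
inductive Temporal (n : ℕ) : Type
  | always (I : TimeInterval) (ψ : NonTemporal n) : Temporal n
  | eventually (I : TimeInterval) (ψ : NonTemporal n) : Temporal n

/-- The non-temporal formula `ψ` inside `φ`. -/
def Temporal.body {n : ℕ} : Temporal n → NonTemporal n
  | .always _ ψ => ψ
  | .eventually _ ψ => ψ

/-- Boolean semantics `(x, t) ⊨ φ`. -/
def Temporal.Sat {n : ℕ} (x : ℝ → State n) (t : ℝ) : Temporal n → Prop
  | .always I ψ => ∀ s ∈ I.window t, ψ.Sat (x s)
  | .eventually I ψ => ∃ s ∈ I.window t, ψ.Sat (x s)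

/-- Robust semantics `ρ^φ(x, t)`. -/
def Temporal.rob {n : ℕ} (η : ℝ) (x : ℝ → State n) (t : ℝ) : Temporal n → EReal
  | .always I ψ => ⨅ s ∈ I.window t, ψ.rob η (x s)
  | .eventually I ψ => ⨆ s ∈ I.window t, ψ.rob η (x s)

/-! ### Prescribed performance control -/

/-- The design parameters. -/
structure Design where
  tStar : ℝ
  χ : ℝ
  ρmax : ℝ
  r : ℝ
  γ₀ : ℝ
  γinf : ℝ
  l : ℝ

/-- The choices allowed for `t_*`: `a` for `G_[a,b] ψ`, any point of `[a, b]` for `F_[a,b] ψ`. -/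
def Temporal.AllowsTime {n : ℕ} : Temporal n → ℝ → Prop
  | .always I _, s => s = I.a
  | .eventually I _, s => I.a ≤ s ∧ (s : EReal) ≤ I.b

/-- The admissible choices of the design parameters for the formula `φ` and the initial state
`x₀`. In the last case, `γinf < ρmax - r` says that the logarithm has a positive argument, i.e. that
the prescribed value of `l` is a real number. -/
structure Design.Admissible {n : ℕ} (d : Design) (η : ℝ) (φ : Temporal n) (x₀ : State n) :
    Prop where
  tStar_mem : φ.AllowsTime d.tStar
  χ_pos : 0 < d.χ
  lt_ρmax : max 0 (φ.body.rob η x₀) < (d.ρmax : EReal)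
  ρmax_le : (d.ρmax : EReal) ≤ φ.body.robOpt η - (d.χ : EReal)
  r_pos : 0 < d.r
  r_lt : d.r < d.ρmax
  lt_γ₀ : d.ρmax - φ.body.robR η x₀ < d.γ₀
  γ₀_le : d.tStar = 0 → d.γ₀ ≤ d.ρmax - d.r
  r_lt_rob : d.tStar = 0 → d.r < φ.body.robR η x₀
  γinf_pos : 0 < d.γinf
  γinf_le : d.γinf ≤ min d.γ₀ (d.ρmax - d.r)
  l_nonneg : d.r ≤ -d.γ₀ + d.ρmax → 0 ≤ d.l
  l_eq : -d.γ₀ + d.ρmax < d.r → d.γinf < d.ρmax - d.r ∧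
    d.l = Real.log ((d.r + d.γinf - d.ρmax) / (-(d.γ₀ - d.γinf))) / (-d.tStar)

/-- The performance function `γ(t) = (γ₀ - γ_∞) exp(-l t) + γ_∞`. -/
def Design.perf (d : Design) (t : ℝ) : ℝ := (d.γ₀ - d.γinf) * Real.exp (-d.l * t) + d.γinf

/-- The normalized error `ξ(x, t) = (ρ^ψ(x) - ρ_max) / γ(t)`. -/
def Design.normErr {n : ℕ} (d : Design) (η : ℝ) (ψ : NonTemporal n) (x : State n) (t : ℝ) : ℝ :=
  (ψ.robR η x - d.ρmax) / d.perf t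

/-- The transformed error `ε(x, t) = ln (-(ξ + 1) / ξ)`, meaningful for `-1 < ξ < 0`. -/
def Design.transErr {n : ℕ} (d : Design) (η : ℝ) (ψ : NonTemporal n) (x : State n) (t : ℝ) : ℝ :=
  Real.log (-((d.normErr η ψ x t + 1) / d.normErr η ψ x t))

/-- The row vector `(∂ρ^ψ/∂x)ᵀ g(x)`. -/
def Plant.inputGrad {n m : ℕ} (P : Plant n m) (η : ℝ) (ψ : NonTemporal n) (x : State n) :
    Fin m → ℝ :=
  (P.g x)ᵀ *ᵥ (gradient (ψ.robR η) x).ofLp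

/-- The continuous feedback law `u(x, t) = -ε(x, t) g(x)ᵀ ∂ρ^ψ/∂x`. -/
def Plant.feedback {n m : ℕ} (P : Plant n m) (d : Design) (η : ℝ) (ψ : NonTemporal n)
    (x : State n) (t : ℝ) : Fin m → ℝ :=
  -d.transErr η ψ x t • P.inputGrad η ψ x

/-- The set `Ω_x` of states with `-1 < ξ(x, 0) < 0`. -/
def Design.stateSet {n : ℕ} (d : Design) (η : ℝ) (ψ : NonTemporal n) : Set (State n) :=
  {x | -1 < d.normErr η ψ x 0 ∧ d.normErr η ψ x 0 < 0}

/-- The constants of the error bound: on `Ω_x`, `k₁` bounds the drift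
`|(∂ρ^ψ/∂x)ᵀ (f(x) + v) - ξ γ̇(s)|` for disturbance values `v ∈ W`, `-1 < ξ < 0` and `s ≥ 0`; `k₂` is
a lower bound of `lam ‖∂ρ^ψ/∂x‖²`; and `k₃` bounds the row-sum norm of `(∂ρ^ψ/∂x)ᵀ g(x)`, which is
the operator norm of `v ↦ (∂ρ^ψ/∂x)ᵀ g(x) v` for the maximum norm on inputs. -/
structure IsGain {n m : ℕ} (P : Plant n m) (lam : ℝ) (W : Set (State n)) (d : Design) (η : ℝ)
    (ψ : NonTemporal n) (k₁ k₂ k₃ : ℝ) : Prop where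
  k₁_pos : 0 < k₁
  k₂_pos : 0 < k₂
  k₃_pos : 0 < k₃
  drift : ∀ x ∈ d.stateSet η ψ, ∀ v ∈ W, ∀ ξ ∈ Set.Ioo (-1 : ℝ) 0, ∀ s : ℝ, 0 ≤ s →
    |inner ℝ (gradient (ψ.robR η) x) (P.f x + v) - ξ * deriv d.perf s| ≤ k₁
  damping : ∀ x ∈ d.stateSet η ψ, k₂ ≤ lam * ‖gradient (ψ.robR η) x‖ ^ 2
  input : ∀ x ∈ d.stateSet η ψ, ∑ j, |P.inputGrad η ψ x j| ≤ k₃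

/-! ### Event-triggered closed loop -/

/-- Triggering instants `0 = t₀ < t₁ < ⋯`; the value `⊤` means that no further event occurs. -/
structure IsTriggerSeq (t : ℕ → EReal) : Prop where
  zero : t 0 = 0
  lt_succ : ∀ i, t i ≠ ⊤ → t i < t (i + 1)
  top_succ : ∀ i, t i = ⊤ → t (i + 1) = ⊤

/-- `(x, û)` is a solution on `[0, T)`, `0 < T ≤ ∞`, of the closed loop
`ẋ = f(x) + g(x) û + w`, `x(0) = x₀`, with the zero-order hold `û(s) = u(x(tᵢ), tᵢ)` on
`[tᵢ, tᵢ₊₁)`. The intervals `[tᵢ, tᵢ₊₁)` have to cover `[0, T)`. -/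
structure IsSolution {n m : ℕ} (P : Plant n m) (w : ℝ → State n) (u : State n → ℝ → Fin m → ℝ)
    (x₀ : State n) (t : ℕ → EReal) (x : ℝ → State n) (uhat : ℝ → Fin m → ℝ) (T : EReal) :
    Prop where
  T_pos : 0 < T
  T_le : T ≤ ⨆ i, t i
  hold : ∀ (i : ℕ) (s : ℝ), t i ≤ (s : EReal) → (s : EReal) < t (i + 1) → (s : EReal) < T →
    uhat s = u (x (t i).toReal) (t i).toReal
  continuous_x : ContinuousOn x {s : ℝ | 0 ≤ s ∧ (s : EReal) < T}
  dynamics : ∀ s : ℝ, 0 ≤ s → (s : EReal) < T →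
    x s = x₀ + ∫ σ in (0 : ℝ)..s, (P.f (x σ) + WithLp.toLp 2 (P.g (x σ) *ᵥ uhat σ) + w σ)

/-- A solution that cannot be continued beyond `T` (for the same triggering instants). -/
structure IsMaximalSolution {n m : ℕ} (P : Plant n m) (w : ℝ → State n)
    (u : State n → ℝ → Fin m → ℝ) (x₀ : State n) (t : ℕ → EReal) (x : ℝ → State n)
    (uhat : ℝ → Fin m → ℝ) (T : EReal) : Prop where
  isSolution : IsSolution P w u x₀ t x uhat T
  maximal : ∀ (x' : ℝ → State n) (uhat' : ℝ → Fin m → ℝ) (T' : EReal),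
    IsSolution P w u x₀ t x' uhat' T' →
    (∀ s : ℝ, 0 ≤ s → (s : EReal) < T → (s : EReal) < T' → x' s = x s) → T' ≤ T

/-- The triggering rule
`tᵢ₊₁ = inf {s > tᵢ | ‖x(s) - x(tᵢ)‖_∞ > δᵢ or s - tᵢ > δᵢ}` along a solution on `[0, T)`
(with `inf ∅ = ⊤`). -/
def ObeysRule {n : ℕ} (δ : ℕ → ℝ) (t : ℕ → EReal) (x : ℝ → State n) (T : EReal) : Prop :=
  ∀ i, t (i + 1) = sInf ((fun s : ℝ => (s : EReal)) '' {s : ℝ | t i < s ∧ (s : EReal) < T ∧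
    (δ i < ‖(x s).ofLp - (x (t i).toReal).ofLp‖ ∨ δ i < s - (t i).toReal)})

end STLControl

end

section

open Set Filter Topology MeasureTheory
open scoped Matrix

namespace STLControl

/-! ### Smooth robustness of non-temporal formulas -/

/-! The control keeps ρ^ψ(x(t)) in the funnel (ρ_max - γ(t), ρ_max), i.e. ξ in (-1, 0). Write û = u
- e with ‖e‖_∞ ≤ δ_u. Then γ ξ' is a drift of size at most k₁ + k₃ δ_u minus ε ‖gᵀ∇ρ^ψ‖², and the
square is at least k₂. If |ε| reaches a level M above both (k₁ + k₃ δ_u)/k₂ and its initial value,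
ξ' points strictly inwards. Since ε is an increasing function of ξ, such levels are constant
barriers for ξ. The comparison needs the derivative only at contact with a barrier, so invariance of
the funnel is a conclusion and not an assumption (`IsSolution.normErr_mem_Icc`). Solutions have only
right derivatives, because û and w may jump; these suffice. Letting M decrease gives the stated
bound.

The constants come from concavity. One bounded superlevel set makes all of them bounded, so Ω_x is
bounded (`exists_norm_le_of_concaveOn`) and continuity gives k₁ and k₃. Some y has ρ^ψ(y) > ρ_max,
and the tangent plane inequality towards y keeps the gradient away from zero on Ω_x; this is k₂
(`exists_isGain`).

Picard–Lindelöf between events and Zorn's lemma give a maximal solution. In the funnel the state is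
bounded, so the solution has a limit at any finite end time before sup tᵢ and could be continued
there; a maximal one therefore reaches sup tᵢ (`IsMaximalSolution.eq_iSup`). Bounded states and
inputs make x Lipschitz, so the event gaps are at least a fixed multiple of δᵢ, whose sum diverges
(`ObeysRule.iSup_eq_top`). Finally γ ≤ ρ_max - r from t_* on, so there ρ^ψ > r. -/

/-- On real arguments `softMin` is given by the real formula. -/
lemma softMin_coe (η a b : ℝ) :
    softMin η (a : EReal) (b : EReal) =
      ((-(1 / η) * Real.log (Real.exp (-η * a) + Real.exp (-η * b)) : ℝ) : EReal) := by
  have hsum : EReal.exp (((-η : ℝ) : EReal) * a) + EReal.exp (((-η : ℝ) : EReal) * b) =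
      ENNReal.ofReal (Real.exp (-η * a) + Real.exp (-η * b)) := by
    rw [← EReal.coe_mul, ← EReal.coe_mul, EReal.exp_coe, EReal.exp_coe,
      ENNReal.ofReal_add (Real.exp_pos _).le (Real.exp_pos _).le]
  rw [softMin, hsum, ENNReal.log_ofReal_of_pos (by positivity), ← EReal.coe_mul]

lemma softMin_comm (η : ℝ) (a b : EReal) : softMin η a b = softMin η b a := by
  rw [softMin, softMin, add_comm]

/-- `⊤` is neutral for `softMin`. -/
lemma softMin_top_right {η : ℝ} (hη : 0 < η) (a : EReal) : softMin η a ⊤ = a := by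
  have h1 : ((-η : ℝ) : EReal) * ⊤ = ⊥ :=
    EReal.coe_mul_top_of_neg (by linarith)
  rw [softMin, h1, EReal.exp_bot, add_zero, EReal.log_exp, ← mul_assoc, ← EReal.coe_mul]
  have h2 : -(1 / η) * -η = 1 := by field_simp
  rw [h2, EReal.coe_one, one_mul]

lemma softMin_top_left {η : ℝ} (hη : 0 < η) (a : EReal) : softMin η ⊤ a = a := by
  rw [softMin_comm, softMin_top_right hη]

/-- Dropping the second exponential lowers the logarithm, and the factor -1/η reverses the
inequality. Hence positive robustness of a conjunction passes to both conjuncts. -/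
lemma neg_inv_mul_log_exp_add_exp_le {η : ℝ} (hη : 0 < η) (a b : ℝ) :
    -(1 / η) * Real.log (Real.exp (-η * a) + Real.exp (-η * b)) ≤ a := by
  have h : -η * a ≤ Real.log (Real.exp (-η * a) + Real.exp (-η * b)) := by
    rw [Real.le_log_iff_exp_le (by positivity)]
    linarith [Real.exp_pos (-η * b)]
  calc -(1 / η) * Real.log (Real.exp (-η * a) + Real.exp (-η * b))
      ≤ -(1 / η) * (-η * a) :=
        mul_le_mul_of_nonpos_left h (by have := one_div_pos.2 hη; linarith)
    _ = a := by field_simp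

/-- The robustness of a formula is identically `+∞` or a continuously differentiable real
function. -/
lemma NonTemporal.rob_eq_top_or_contDiff {n : ℕ} {η : ℝ} (hη : 0 < η) (ψ : NonTemporal n) :
    (∀ x, ψ.rob η x = ⊤) ∨ ∃ h : State n → ℝ, ContDiff ℝ 1 h ∧ ∀ x, ψ.rob η x = (h x : EReal) := by
  induction ψ with
  | top => exact .inl fun _ => rfl
  | pred μ => exact .inr ⟨μ.h, μ.contDiff_h, fun _ => rfl⟩
  | neg μ => exact .inr ⟨fun x => -μ.h x, μ.contDiff_h.neg, fun _ => rfl⟩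
  | and ψ₁ ψ₂ ih₁ ih₂ =>
    rcases ih₁ with h₁ | ⟨f, hf, hf'⟩ <;> rcases ih₂ with h₂ | ⟨k, hk, hk'⟩
    · exact .inl fun x => by simp only [NonTemporal.rob, h₁, h₂, softMin_top_left hη]
    · exact .inr ⟨k, hk, fun x => by simp only [NonTemporal.rob, h₁, hk', softMin_top_left hη]⟩
    · exact .inr ⟨f, hf, fun x => by simp only [NonTemporal.rob, hf', h₂, softMin_top_right hη]⟩
    · refine .inr ⟨fun x => -(1 / η) * Real.log (Real.exp (-η * f x) + Real.exp (-η * k x)), ?_,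
        fun x => by simp only [NonTemporal.rob, hf', hk', softMin_coe]⟩
      refine contDiff_const.mul (ContDiff.log ?_ fun x => ?_)
      · exact (contDiff_const.mul hf).exp.add (contDiff_const.mul hk).exp
      · positivity

/-- Away from the trivial case, `robR` is continuously differentiable and represents `rob`. -/
lemma NonTemporal.contDiff_robR {n : ℕ} {η : ℝ} (hη : 0 < η) {ψ : NonTemporal n} {x₀ : State n}
    (h₀ : ψ.rob η x₀ ≠ ⊤) :
    ContDiff ℝ 1 (ψ.robR η) ∧ ∀ x, ψ.rob η x = (ψ.robR η x : EReal) := by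
  -- The alternative is uniform in the state, so a single finite value rules out the trivial case.
  rcases ψ.rob_eq_top_or_contDiff hη with h | ⟨h, hh, hr⟩
  · exact absurd (h x₀) h₀
  · have : ψ.robR η = h := by
      funext x
      simp [NonTemporal.robR, hr]
    rw [this]
    exact ⟨hh, hr⟩

lemma softMin_le_left {η : ℝ} (hη : 0 < η) {a b : EReal} (ha : a ≠ ⊥) (hb : b ≠ ⊥) :
    softMin η a b ≤ a := by
  induction a with
  | bot => exact absurd rfl ha
  | top => exact le_top
  | coe a =>
    induction b with
    | bot => exact absurd rfl hb
    | top => rw [softMin_top_right hη]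
    | coe b =>
      rw [softMin_coe]
      exact_mod_cast neg_inv_mul_log_exp_add_exp_le hη a b

lemma NonTemporal.rob_ne_bot {n : ℕ} {η : ℝ} (hη : 0 < η) (ψ : NonTemporal n) (x : State n) :
    ψ.rob η x ≠ ⊥ := by
  rcases ψ.rob_eq_top_or_contDiff hη with h | ⟨h, -, hr⟩
  · simp [h]
  · simp [hr]

/-- Positive robustness implies satisfaction. -/
lemma NonTemporal.sat_of_rob_pos {n : ℕ} {η : ℝ} (hη : 0 < η) {ψ : NonTemporal n} {x : State n}
    (h : 0 < ψ.rob η x) : ψ.Sat x := by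
  induction ψ with
  | top => trivial
  | pred μ => exact (EReal.coe_pos.1 h).le
  | neg μ =>
    have : 0 < -μ.h x := EReal.coe_pos.1 h
    exact not_le.2 (by linarith)
  | and ψ₁ ψ₂ ih₁ ih₂ =>
    have b₁ := ψ₁.rob_ne_bot hη x
    have b₂ := ψ₂.rob_ne_bot hη x
    refine ⟨ih₁ (h.trans_le (softMin_le_left hη b₁ b₂)), ih₂ (h.trans_le ?_)⟩
    simp only [NonTemporal.rob]
    rw [softMin_comm]
    exact softMin_le_left hη b₂ b₁

/-! ### The design parameters -/

section Design

variable {n : ℕ} {d : Design} {η : ℝ} {φ : Temporal n} {x₀ : State n}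

lemma Temporal.AllowsTime.nonneg {s : ℝ} (h : φ.AllowsTime s) : 0 ≤ s := by
  cases φ with
  | always I ψ => exact (show s = I.a from h) ▸ I.a_nonneg
  | eventually I ψ => exact I.a_nonneg.trans h.1

/-- The real number ρ_max lies strictly above the initial robustness. This excludes trivial
formulas, so `robR` represents the robustness from here on. -/
lemma Design.Admissible.rob_ne_top (hd : d.Admissible η φ x₀) : φ.body.rob η x₀ ≠ ⊤ := by
  intro h
  have := hd.lt_ρmax
  rw [h] at this
  simp at this

lemma Design.Admissible.ρmax_pos (hd : d.Admissible η φ x₀) : 0 < d.ρmax := by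
  have := (le_max_left _ _).trans_lt hd.lt_ρmax
  exact_mod_cast this

lemma Design.Admissible.robR_lt (hη : 0 < η) (hd : d.Admissible η φ x₀) :
    φ.body.robR η x₀ < d.ρmax := by
  have := (le_max_right _ _).trans_lt hd.lt_ρmax
  rw [(NonTemporal.contDiff_robR hη hd.rob_ne_top).2] at this
  exact_mod_cast this

lemma Design.Admissible.γinf_le_γ₀ (hd : d.Admissible η φ x₀) : d.γinf ≤ d.γ₀ :=
  hd.γinf_le.trans (min_le_left _ _)

/-- In the case of a prescribed rate, `l` is positive and `γ(t_*) = ρ_max - r`. -/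
lemma Design.Admissible.rate_spec (hd : d.Admissible η φ x₀) (h : -d.γ₀ + d.ρmax < d.r) :
    0 ≤ d.l ∧ (d.γ₀ - d.γinf) * Real.exp (-d.l * d.tStar) + d.γinf = d.ρmax - d.r := by
  obtain ⟨h1, h2⟩ := hd.l_eq h
  -- For t_* = 0 the design requires γ₀ ≤ ρ_max - r, which is the other case; so the formula for the
  -- rate does not divide by zero.
  have ht : 0 < d.tStar := by
    refine lt_of_le_of_ne hd.tStar_mem.nonneg fun h0 => ?_
    have := hd.γ₀_le h0.symm
    linarith
  have hpos : 0 < d.γ₀ - d.γinf := by linarith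
  have hA : (d.r + d.γinf - d.ρmax) / (-(d.γ₀ - d.γinf)) =
      (d.ρmax - d.r - d.γinf) / (d.γ₀ - d.γinf) := by
    rw [div_neg, ← neg_div]
    ring_nf
  have hA0 : 0 < (d.ρmax - d.r - d.γinf) / (d.γ₀ - d.γinf) := div_pos (by linarith) hpos
  -- Here γ₀ > ρ_max - r, so the logarithm is nonpositive and division by -t_* makes the rate
  -- nonnegative.
  have hA1 : (d.ρmax - d.r - d.γinf) / (d.γ₀ - d.γinf) ≤ 1 :=
    (div_le_one hpos).2 (by linarith)
  rw [hA] at h2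
  constructor
  · rw [h2]
    exact div_nonneg_of_nonpos (Real.log_nonpos hA0.le hA1) (by linarith)
  · have : -d.l * d.tStar = Real.log ((d.ρmax - d.r - d.γinf) / (d.γ₀ - d.γinf)) := by
      rw [h2]
      field_simp
    rw [this, Real.exp_log hA0]
    field_simp
    ring

lemma Design.Admissible.rate_nonneg (hd : d.Admissible η φ x₀) : 0 ≤ d.l := by
  rcases le_or_gt d.r (-d.γ₀ + d.ρmax) with h | h
  · exact hd.l_nonneg h
  · exact (hd.rate_spec h).1

lemma Design.perf_zero (d : Design) : d.perf 0 = d.γ₀ := by simp [Design.perf]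

lemma Design.Admissible.perf_pos (hd : d.Admissible η φ x₀) (t : ℝ) : 0 < d.perf t := by
  have := mul_nonneg (sub_nonneg.2 hd.γinf_le_γ₀) (Real.exp_pos (-d.l * t)).le
  have := hd.γinf_pos
  unfold Design.perf
  linarith

lemma Design.Admissible.perf_antitone (hd : d.Admissible η φ x₀) : Antitone d.perf := by
  intro s t hst
  have h1 : Real.exp (-d.l * t) ≤ Real.exp (-d.l * s) :=
    Real.exp_le_exp.2 (by nlinarith [hd.rate_nonneg])
  have := mul_le_mul_of_nonneg_left h1 (sub_nonneg.2 hd.γinf_le_γ₀)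
  unfold Design.perf
  linarith

/-- Either γ₀ is already small enough and γ decreases, or the rate was chosen to give equality. The
lower edge of the funnel is thus at least r from t_* on. -/
lemma Design.Admissible.perf_tStar_le (hd : d.Admissible η φ x₀) :
    d.perf d.tStar ≤ d.ρmax - d.r := by
  rcases le_or_gt d.r (-d.γ₀ + d.ρmax) with h | h
  · have := hd.perf_antitone hd.tStar_mem.nonneg
    rw [d.perf_zero] at this
    linarith
  · exact (hd.rate_spec h).2.le

lemma Design.hasDerivAt_perf (d : Design) (t : ℝ) :
    HasDerivAt d.perf ((d.γ₀ - d.γinf) * (Real.exp (-d.l * t) * (-d.l))) t := by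
  have h : HasDerivAt (fun s : ℝ => -d.l * s) (-d.l) t := by
    simpa using (hasDerivAt_id t).const_mul (-d.l)
  exact (h.exp.const_mul _).add_const _

lemma Design.Admissible.abs_deriv_perf_le (hd : d.Admissible η φ x₀) {s : ℝ} (hs : 0 ≤ s) :
    |deriv d.perf s| ≤ (d.γ₀ - d.γinf) * d.l := by
  have hl := hd.rate_nonneg
  have hγ := sub_nonneg.2 hd.γinf_le_γ₀
  have he : Real.exp (-d.l * s) ≤ 1 := Real.exp_le_one_iff.2 (by nlinarith)
  rw [(d.hasDerivAt_perf s).deriv, abs_mul, abs_mul, abs_of_nonneg hγ, abs_neg, abs_of_nonneg hl,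
    abs_of_pos (Real.exp_pos _)]
  exact mul_le_mul_of_nonneg_left (mul_le_of_le_one_left hl he) hγ

/-- `-1 < ξ < 0` is the funnel condition `ρ_max - γ(t) < ρ^ψ < ρ_max`. -/
lemma Design.Admissible.normErr_mem_Ioo_iff (hd : d.Admissible η φ x₀) {x : State n} {t : ℝ} :
    d.normErr η φ.body x t ∈ Ioo (-1 : ℝ) 0 ↔
      d.ρmax - d.perf t < φ.body.robR η x ∧ φ.body.robR η x < d.ρmax := by
  have := hd.perf_pos t
  rw [Design.normErr, mem_Ioo, lt_div_iff₀ this, div_lt_iff₀ this]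
  constructor <;> rintro ⟨h1, h2⟩ <;> constructor <;> linarith

lemma Design.Admissible.mem_stateSet_iff (hd : d.Admissible η φ x₀) {x : State n} :
    x ∈ d.stateSet η φ.body ↔
      d.ρmax - d.γ₀ < φ.body.robR η x ∧ φ.body.robR η x < d.ρmax := by
  have := hd.normErr_mem_Ioo_iff (x := x) (t := 0)
  rwa [d.perf_zero] at this

/-- The funnel only shrinks, so constants valid on the initial set Ω_x serve at all times. -/
lemma Design.Admissible.mem_stateSet_of_normErr (hd : d.Admissible η φ x₀) {x : State n} {t : ℝ}
    (ht : 0 ≤ t) (h : d.normErr η φ.body x t ∈ Ioo (-1 : ℝ) 0) : x ∈ d.stateSet η φ.body := by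
  rw [hd.mem_stateSet_iff]
  rw [hd.normErr_mem_Ioo_iff] at h
  have := hd.perf_antitone ht
  rw [d.perf_zero] at this
  exact ⟨by linarith, h.2⟩

lemma Design.Admissible.normErr_init (hη : 0 < η) (hd : d.Admissible η φ x₀) :
    d.normErr η φ.body x₀ 0 ∈ Ioo (-1 : ℝ) 0 := by
  rw [hd.normErr_mem_Ioo_iff, d.perf_zero]
  exact ⟨by linarith [hd.lt_γ₀], hd.robR_lt hη⟩

end Design

/-! ### Concave functions with a bounded superlevel set -/

/-- If one superlevel set of a concave function, below an attained value, is bounded, then all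
superlevel sets are. -/
lemma exists_norm_le_of_concaveOn {E : Type*} [NormedAddCommGroup E] [NormedSpace ℝ E]
    {f : E → ℝ} (hf : ConcaveOn ℝ univ f) {C : ℝ} (hC : ∀ x, 0 < f x → ‖x‖ ≤ C) {y : E}
    (hy : 0 < f y) (c : ℝ) : ∃ R, ∀ x, c ≤ f x → ‖x‖ ≤ R := by
  set b := |c| with hb
  have hb0 : 0 ≤ b := abs_nonneg c
  -- With this weight concavity gives at least f y - s (f y + b) = f y / 2 > 0 at (1 - s) y + s x.
  -- That point is therefore bounded by `C`, which bounds `x`.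
  set s := f y / (2 * (f y + b)) with hs
  have hs0 : 0 < s := by positivity
  have hs1 : s ≤ 1 := by
    rw [hs, div_le_one (by positivity)]
    linarith
  have hsb : s * (f y + b) = f y / 2 := by
    rw [hs]
    field_simp
  refine ⟨(C + ‖y‖) / s, fun x hx => ?_⟩
  have h1 := hf.2 (mem_univ y) (mem_univ x) (sub_nonneg.2 hs1) hs0.le (by ring)
  simp only [smul_eq_mul] at h1
  have h2 : -b ≤ f x := (neg_abs_le c).trans hx
  have h3 := hC ((1 - s) • y + s • x) (by nlinarith)
  have h4 : s • x = ((1 - s) • y + s • x) - (1 - s) • y := by abel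
  have h5 : s * ‖x‖ ≤ C + ‖y‖ := by
    calc s * ‖x‖ = ‖s • x‖ := by rw [norm_smul, Real.norm_of_nonneg hs0.le]
      _ ≤ ‖(1 - s) • y + s • x‖ + ‖(1 - s) • y‖ := by
        conv_lhs => rw [h4]
        exact norm_sub_le _ _
      _ ≤ C + ‖y‖ := by
        rw [norm_smul, Real.norm_of_nonneg (sub_nonneg.2 hs1)]
        nlinarith [norm_nonneg y]
  rw [le_div_iff₀ hs0]
  linarith

/-- The graph of a differentiable concave function lies below its tangent planes. -/
lemma sub_le_inner_gradient_of_concaveOn {E : Type*} [NormedAddCommGroup E] [InnerProductSpace ℝ E]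
    [CompleteSpace E] {f : E → ℝ} (hf : ConcaveOn ℝ univ f) {x : E}
    (hx : DifferentiableAt ℝ f x) (y : E) : f y - f x ≤ inner ℝ (gradient f x) (y - x) := by
  -- On the line through `x` and `y`, the slope over [0, 1] is at most the derivative at 0.
  have hline : ConcaveOn ℝ univ (f ∘ AffineMap.lineMap (k := ℝ) x y) := by
    simpa using hf.comp_affineMap (AffineMap.lineMap (k := ℝ) x y)
  have hd : HasDerivAt (f ∘ AffineMap.lineMap (k := ℝ) x y)
      (inner ℝ (gradient f x) (y - x)) 0 := by
    rw [inner_gradient_left]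
    refine HasFDerivAt.comp_hasDerivAt (𝕜 := ℝ) (0 : ℝ) ?_ AffineMap.hasDerivAt_lineMap
    simpa using hx.hasFDerivAt
  have := hline.slope_le_of_hasDerivAt (mem_univ 0) (mem_univ 1) zero_lt_one hd
  simpa [slope_def_field] using this

/-! ### Existence of admissible constants -/

lemma continuous_gradient {E : Type*} [NormedAddCommGroup E] [InnerProductSpace ℝ E]
    [CompleteSpace E] {f : E → ℝ} (hf : ContDiff ℝ 1 f) : Continuous (gradient f) :=
  (InnerProductSpace.toDual ℝ E).symm.continuous.comp (hf.continuous_fderiv one_ne_zero)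

lemma Plant.IsRegular.continuous_g {n m : ℕ} {P : Plant n m} {lam : ℝ} (hP : P.IsRegular lam) :
    Continuous P.g :=
  continuous_matrix fun i j => (hP.lipschitz_g i j).continuous

lemma Plant.IsRegular.continuous_inputGrad {n m : ℕ} {P : Plant n m} {lam : ℝ}
    (hP : P.IsRegular lam) {η : ℝ} {ψ : NonTemporal n} (hψ : ContDiff ℝ 1 (ψ.robR η)) :
    Continuous (P.inputGrad η ψ) :=
  hP.continuous_g.matrix_transpose.matrix_mulVec
    ((PiLp.continuous_ofLp 2 _).comp (continuous_gradient hψ))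

section Gain

variable {n m : ℕ} {P : Plant n m} {lam : ℝ} {W : Set (State n)} {d : Design} {η : ℝ}
  {φ : Temporal n} {x₀ : State n}

/-- The prescribed maximum `ρ_max` is exceeded somewhere. -/
lemma Design.Admissible.exists_ρmax_lt (hη : 0 < η) (hd : d.Admissible η φ x₀) :
    ∃ y, d.ρmax < φ.body.robR η y := by
  have h1 : (d.ρmax : EReal) < φ.body.robOpt η := by
    have h := hd.ρmax_le
    have hχ := hd.χ_pos
    generalize φ.body.robOpt η = s at h ⊢
    induction s with
    | bot => simp at h
    | top => exact EReal.coe_lt_top _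
    | coe s =>
      have h' : d.ρmax ≤ s - d.χ := by exact_mod_cast h
      exact_mod_cast (by linarith : d.ρmax < s)
  obtain ⟨y, hy⟩ := lt_iSup_iff.1 h1
  rw [(NonTemporal.contDiff_robR hη hd.rob_ne_top).2] at hy
  exact ⟨y, by exact_mod_cast hy⟩

/-- `Ω_x` is bounded. -/
lemma Design.Admissible.exists_norm_le_of_mem_stateSet (hη : 0 < η)
    (hconc : ConcaveOn ℝ univ (φ.body.robR η)) (hwell : φ.body.WellPosed η)
    (hd : d.Admissible η φ x₀) : ∃ R, ∀ x ∈ d.stateSet η φ.body, ‖x‖ ≤ R := by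
  obtain ⟨y, hy⟩ := hd.exists_ρmax_lt hη
  obtain ⟨C, hC⟩ := hwell
  have hr := (NonTemporal.contDiff_robR hη hd.rob_ne_top).2
  obtain ⟨R, hR⟩ := exists_norm_le_of_concaveOn hconc
    (fun x hx => hC x (by rw [hr]; exact_mod_cast hx)) (hd.ρmax_pos.trans hy) (d.ρmax - d.γ₀)
  exact ⟨R, fun x hx => hR x (hd.mem_stateSet_iff.1 hx).1.le⟩

/-- Admissible constants exist. -/
theorem exists_isGain (hP : P.IsRegular lam) (hW : Bornology.IsBounded W) (hη : 0 < η)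
    (hconc : ConcaveOn ℝ univ (φ.body.robR η)) (hwell : φ.body.WellPosed η)
    (hd : d.Admissible η φ x₀) : ∃ k₁ k₂ k₃ : ℝ, IsGain P lam W d η φ.body k₁ k₂ k₃ := by
  have hψ := (NonTemporal.contDiff_robR hη hd.rob_ne_top).1
  obtain ⟨R, hR⟩ := hd.exists_norm_le_of_mem_stateSet hη hconc hwell
  obtain ⟨y, hy⟩ := hd.exists_ρmax_lt hη
  obtain ⟨B, hB⟩ := hW.exists_norm_le
  have hK : IsCompact (Metric.closedBall (0 : State n) R) := isCompact_closedBall _ _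
  have hmem : ∀ x ∈ d.stateSet η φ.body, x ∈ Metric.closedBall (0 : State n) R := fun x hx => by
    simpa using hR x hx
  obtain ⟨G, hG⟩ := hK.exists_bound_of_continuousOn (continuous_gradient hψ).continuousOn
  obtain ⟨F, hF⟩ := hK.exists_bound_of_continuousOn hP.lipschitz_f.continuous.continuousOn
  obtain ⟨H, hH⟩ := hK.exists_bound_of_continuousOn
    (f := fun x => ∑ j, |P.inputGrad η φ.body x j|)
    (continuous_finsetSum _ fun j _ =>
      ((continuous_apply j).comp (hP.continuous_inputGrad hψ)).abs).continuousOn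
  have hlg := mul_nonneg (sub_nonneg.2 hd.γinf_le_γ₀) hd.rate_nonneg
  -- k₁ combines Cauchy–Schwarz with the bound on γ̇, and k₂ is the squared tangent plane bound
  -- towards `y`. The absolute values and the summands 1 ensure positivity, since bounds over
  -- possibly empty sets may be negative.
  refine ⟨|G| * (|F| + |B|) + (d.γ₀ - d.γinf) * d.l + 1,
    lam * ((φ.body.robR η y - d.ρmax) / (‖y‖ + |R| + 1)) ^ 2, |H| + 1, ?_, ?_, ?_, ?_, ?_, ?_⟩
  · positivity
  · have := hP.lam_pos
    have := sub_pos.2 hy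
    positivity
  · positivity
  · intro x hx v hv ξ hξ s hs
    have h1 : |inner ℝ (gradient (φ.body.robR η) x) (P.f x + v)| ≤ |G| * (|F| + |B|) := by
      refine (abs_real_inner_le_norm _ _).trans ?_
      have e1 := (hG x (hmem x hx)).trans (le_abs_self G)
      have e2 := (norm_add_le (P.f x) v).trans (add_le_add
        ((hF x (hmem x hx)).trans (le_abs_self F)) ((hB v hv).trans (le_abs_self B)))
      exact mul_le_mul e1 e2 (norm_nonneg _) (abs_nonneg _)
    have h2 : |ξ * deriv d.perf s| ≤ (d.γ₀ - d.γinf) * d.l := by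
      rw [abs_mul]
      have : |ξ| ≤ 1 := abs_le.2 ⟨hξ.1.le, by linarith [hξ.2]⟩
      exact (mul_le_of_le_one_left (abs_nonneg _) this).trans (hd.abs_deriv_perf_le hs)
    linarith [abs_sub (inner ℝ (gradient (φ.body.robR η) x) (P.f x + v)) (ξ * deriv d.perf s)]
  · intro x hx
    have h1 := sub_le_inner_gradient_of_concaveOn hconc (hψ.differentiable one_ne_zero x) y
    have h2 := (hd.mem_stateSet_iff.1 hx).2
    have h3 : ‖y - x‖ ≤ ‖y‖ + |R| + 1 := by
      linarith [norm_sub_le y x, hR x hx, le_abs_self R]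
    have h4 : φ.body.robR η y - d.ρmax ≤
        ‖gradient (φ.body.robR η) x‖ * (‖y‖ + |R| + 1) := by
      have := (real_inner_le_norm (gradient (φ.body.robR η) x) (y - x)).trans
        (mul_le_mul_of_nonneg_left h3 (norm_nonneg _))
      linarith
    have h5 : (φ.body.robR η y - d.ρmax) / (‖y‖ + |R| + 1) ≤ ‖gradient (φ.body.robR η) x‖ :=
      (div_le_iff₀ (by positivity)).2 h4
    have h6 : 0 ≤ (φ.body.robR η y - d.ρmax) / (‖y‖ + |R| + 1) :=
      div_nonneg (sub_pos.2 hy).le (by positivity)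
    exact mul_le_mul_of_nonneg_left (pow_le_pow_left₀ h6 h5 2) hP.lam_pos.le
  · intro x hx
    have := (le_abs_self _).trans (hH x (hmem x hx))
    linarith [le_abs_self H]

end Gain

/-! ### Triggering instants -/

section Trigger

variable {t : ℕ → EReal}

lemma IsTriggerSeq.monotone (ht : IsTriggerSeq t) : Monotone t := by
  refine monotone_nat_of_le_succ fun i => ?_
  rcases eq_or_ne (t i) ⊤ with h | h
  · rw [h, ht.top_succ i h]
  · exact (ht.lt_succ i h).le

lemma IsTriggerSeq.nonneg (ht : IsTriggerSeq t) (i : ℕ) : 0 ≤ t i :=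
  ht.zero ▸ ht.monotone (Nat.zero_le i)

/-- Every time before `sup tᵢ` lies in exactly one interval `[tᵢ, tᵢ₊₁)`. -/
lemma IsTriggerSeq.exists_mem (ht : IsTriggerSeq t) {s : ℝ} (hs : 0 ≤ s)
    (h : (s : EReal) < ⨆ i, t i) : ∃ i, t i ≤ (s : EReal) ∧ (s : EReal) < t (i + 1) := by
  classical
  -- The first index whose instant exceeds `s` is not 0, because t₀ = 0 ≤ s; its predecessor is the
  -- index sought.
  have hex := lt_iSup_iff.1 h
  have hne : Nat.find hex ≠ 0 := fun h0 => by
    have := Nat.find_spec hex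
    rw [h0, ht.zero] at this
    exact absurd this (not_lt.2 (by exact_mod_cast hs))
  obtain ⟨k, hk⟩ := Nat.exists_eq_succ_of_ne_zero hne
  refine ⟨k, not_lt.1 (Nat.find_min hex (by omega)), ?_⟩
  have := Nat.find_spec hex
  rwa [hk] at this

lemma IsTriggerSeq.le_of_le_of_lt (ht : IsTriggerSeq t) {i j : ℕ} {s : EReal} (hi : t i ≤ s)
    (hj : s < t (j + 1)) : i ≤ j := by
  by_contra hij
  exact absurd (hj.trans_le ((ht.monotone (by omega : j + 1 ≤ i)).trans hi)) (lt_irrefl _)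

lemma IsTriggerSeq.coe_toReal (ht : IsTriggerSeq t) {i : ℕ} {s : ℝ} (hi : t i ≤ (s : EReal)) :
    (((t i).toReal : ℝ) : EReal) = t i :=
  EReal.coe_toReal (hi.trans_lt (EReal.coe_lt_top s)).ne
    (EReal.bot_lt_zero.trans_le (ht.nonneg i)).ne'

lemma IsTriggerSeq.toReal_mem (ht : IsTriggerSeq t) {i : ℕ} {s : ℝ} (hi : t i ≤ (s : EReal)) :
    0 ≤ (t i).toReal ∧ (t i).toReal ≤ s := by
  refine ⟨EReal.toReal_nonneg (ht.nonneg i), ?_⟩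
  rw [← ht.coe_toReal hi] at hi
  exact_mod_cast hi

end Trigger

/-! ### The vector field for a constant input -/

/-- The vector field `f + g c` of the plant with constant input `c`. -/
def Plant.rhs {n m : ℕ} (P : Plant n m) (c : Fin m → ℝ) (x : State n) : State n :=
  P.f x + WithLp.toLp 2 (P.g x *ᵥ c)

lemma Plant.IsRegular.continuous_rhs {n m : ℕ} {P : Plant n m} {lam : ℝ} (hP : P.IsRegular lam)
    (c : Fin m → ℝ) : Continuous (P.rhs c) :=
  hP.lipschitz_f.continuous.add
    ((PiLp.continuous_toLp 2 _).comp (hP.continuous_g.matrix_mulVec continuous_const))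

lemma LocallyLipschitz.finset_sum {α ι E : Type*} [PseudoEMetricSpace α]
    [SeminormedAddCommGroup E] {f : ι → α → E} (s : Finset ι) (h : ∀ i, LocallyLipschitz (f i)) :
    LocallyLipschitz fun x => ∑ i ∈ s, f i x := by
  classical
  induction s using Finset.induction_on with
  | empty => simpa using LocallyLipschitz.const (0 : E)
  | insert a s ha ih =>
    simp only [Finset.sum_insert ha]
    exact LocallyLipschitz.add (h a) ih

lemma Plant.IsRegular.locallyLipschitz_rhs {n m : ℕ} {P : Plant n m} {lam : ℝ}
    (hP : P.IsRegular lam) (c : Fin m → ℝ) : LocallyLipschitz (P.rhs c) := by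
  -- Regularity of `g` is given entrywise, so g(x) c is expanded into its scalar entries times fixed
  -- vectors.
  have h : P.rhs c = fun x => P.f x + ∑ i, ∑ j,
      (ContinuousLinearMap.toSpanSingleton ℝ (c j • EuclideanSpace.single i (1 : ℝ)))
        (P.g x i j) := by
    funext x
    rw [Plant.rhs]
    congr 1
    ext k
    simp [Matrix.mulVec, dotProduct, Finset.sum_apply, Pi.single_apply, Finset.sum_ite_eq]
  rw [h]
  exact LocallyLipschitz.add hP.lipschitz_f (LocallyLipschitz.finset_sum _ fun i =>
    LocallyLipschitz.finset_sum _ fun j =>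
      (ContinuousLinearMap.lipschitz _).locallyLipschitz.comp (hP.lipschitz_g i j))

/-! ### Integrability of the closed-loop dynamics -/

section Integrable

variable {n m : ℕ} {P : Plant n m} {lam : ℝ} {W : Set (State n)} {w : ℝ → State n}
  {t : ℕ → EReal} {x : ℝ → State n} {uhat : ℝ → Fin m → ℝ}

/-- The function is bounded, and continuous off a finite set, which is null. -/
lemma PiecewiseContinuous.integrableOn (hw : PiecewiseContinuous w) (hW : Bornology.IsBounded W)
    (hwW : ∀ s : ℝ, 0 ≤ s → w s ∈ W) (b : ℝ) : IntegrableOn w (Ico 0 b) := by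
  obtain ⟨B, hB⟩ := hW.exists_norm_le
  set D := {s : ℝ | 0 ≤ s ∧ s ≤ b ∧ ¬ ContinuousWithinAt w (Ici 0) s} with hD
  have hDf : D.Finite := hw.finite_disc b
  have hae : (Ico 0 b \ D : Set ℝ) =ᵐ[volume] Ico 0 b :=
    sdiff_null_ae_eq_self (hDf.measure_zero _)
  have hm : MeasurableSet (Ico 0 b \ D) := measurableSet_Ico.diff hDf.measurableSet
  have hcont : ContinuousOn w (Ico 0 b \ D) := by
    intro s hs
    have h : ContinuousWithinAt w (Ici 0) s := by
      by_contra h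
      exact hs.2 ⟨hs.1.1, hs.1.2.le, h⟩
    exact h.mono fun y hy => hy.1.1
  have h : IntegrableOn w (Ico 0 b \ D) := by
    refine IntegrableOn.of_bound ?_ (hcont.aestronglyMeasurable hm) B ?_
    · exact (measure_mono sdiff_subset).trans_lt measure_Ico_lt_top
    · exact (ae_restrict_mem hm).mono fun s hs => hB _ (hwW s hs.1.1)
  exact h.congr_set_ae hae.symm

/-- The closed-loop dynamics are integrable along a bounded continuous curve, as long as only
finitely many events occur. -/
lemma integrableOn_dynamics (hP : P.IsRegular lam) (hW : Bornology.IsBounded W)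
    (hw : PiecewiseContinuous w) (hwW : ∀ s : ℝ, 0 ≤ s → w s ∈ W) (ht : IsTriggerSeq t) {b : ℝ}
    (hb : (b : EReal) < ⨆ i, t i) (hx : ContinuousOn x (Ico 0 b)) {R : ℝ}
    (hR : ∀ s ∈ Ico 0 b, ‖x s‖ ≤ R) {c : ℕ → Fin m → ℝ}
    (hc : ∀ (i : ℕ) (s : ℝ), s ∈ Ico 0 b → t i ≤ (s : EReal) → (s : EReal) < t (i + 1) →
      uhat s = c i) :
    IntegrableOn (fun s => P.rhs (uhat s) (x s) + w s) (Ico 0 b) := by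
  -- The first `N` sampling intervals cover [0, b), and the input is constant on each of them.
  obtain ⟨N, hN⟩ := lt_iSup_iff.1 hb
  set E : ℕ → Set ℝ := fun i => Ico 0 b ∩ {s : ℝ | t i ≤ (s : EReal) ∧ (s : EReal) < t (i + 1)}
    with hE
  have hcover : Ico 0 b ⊆ ⋃ i ∈ Finset.range N, E i := by
    intro s hs
    have hsb : (s : EReal) < b := by exact_mod_cast hs.2
    obtain ⟨i, hi⟩ := ht.exists_mem hs.1 (hsb.trans hb)
    have hiN : i < N := by
      by_contra h
      exact absurd ((ht.monotone (not_lt.1 h)).trans hi.1) (not_le.2 (hsb.trans hN))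
    exact mem_biUnion (Finset.mem_coe.2 (Finset.mem_range.2 hiN)) ⟨hs, hi⟩
  refine IntegrableOn.mono_set ?_ hcover
  rw [integrableOn_finset_iUnion]
  intro i _
  have hEm : MeasurableSet (E i) := by
    refine measurableSet_Ico.inter (MeasurableSet.inter ?_ ?_)
    · exact measurableSet_le measurable_const measurable_coe_real_ereal
    · exact measurableSet_lt measurable_coe_real_ereal measurable_const
  have hcont : ContinuousOn (fun s => P.rhs (c i) (x s)) (Ico 0 b) :=
    (hP.continuous_rhs (c i)).comp_continuousOn hx
  obtain ⟨M, hM⟩ := (isCompact_closedBall (0 : State n) R).exists_bound_of_continuousOn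
    (hP.continuous_rhs (c i)).continuousOn
  have h1 : IntegrableOn (fun s => P.rhs (c i) (x s)) (Ico 0 b) := by
    refine IntegrableOn.of_bound measure_Ico_lt_top
      (hcont.aestronglyMeasurable measurableSet_Ico) M ?_
    exact (ae_restrict_mem measurableSet_Ico).mono fun s hs =>
      hM _ (by simpa using hR s hs)
  refine ((h1.add (hw.integrableOn hW hwW b)).mono_set inter_subset_left).congr_fun ?_ hEm
  intro s hs
  simp only [Pi.add_apply, hc i s hs.1 hs.2.1 hs.2.2]

end Integrable

section Solution

variable {n m : ℕ} {P : Plant n m} {lam : ℝ} {W : Set (State n)} {w : ℝ → State n}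
  {u : State n → ℝ → Fin m → ℝ} {x₀ : State n} {t : ℕ → EReal} {x : ℝ → State n}
  {uhat : ℝ → Fin m → ℝ} {T : EReal}

lemma IsSolution.eq_integral (h : IsSolution P w u x₀ t x uhat T) {s : ℝ} (hs : 0 ≤ s)
    (hsT : (s : EReal) < T) : x s = x₀ + ∫ σ in (0 : ℝ)..s, (P.rhs (uhat σ) (x σ) + w σ) :=
  h.dynamics s hs hsT

lemma IsSolution.initial (h : IsSolution P w u x₀ t x uhat T) : x 0 = x₀ := by
  simpa using h.eq_integral le_rfl (by exact_mod_cast h.T_pos)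

lemma IsSolution.continuousOn_Icc (h : IsSolution P w u x₀ t x uhat T) {b : ℝ}
    (hb : (b : EReal) < T) : ContinuousOn x (Icc 0 b) :=
  h.continuous_x.mono fun _ hs => ⟨hs.1, (EReal.coe_le_coe_iff.2 hs.2).trans_lt hb⟩

lemma IsSolution.integrableOn (hP : P.IsRegular lam) (hW : Bornology.IsBounded W)
    (hw : PiecewiseContinuous w) (hwW : ∀ s : ℝ, 0 ≤ s → w s ∈ W) (ht : IsTriggerSeq t)
    (h : IsSolution P w u x₀ t x uhat T) {b : ℝ} (hb : (b : EReal) < T) :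
    IntegrableOn (fun s => P.rhs (uhat s) (x s) + w s) (Ico 0 b) := by
  obtain ⟨R, hR⟩ := (isCompact_Icc (a := (0 : ℝ)) (b := b)).exists_bound_of_continuousOn
    (h.continuousOn_Icc hb)
  exact integrableOn_dynamics hP hW hw hwW ht (hb.trans_le h.T_le)
    ((h.continuousOn_Icc hb).mono Ico_subset_Icc_self) (fun s hs => hR s ⟨hs.1, hs.2.le⟩)
    (fun i _ hs h1 h2 => h.hold i _ h1 h2 ((EReal.coe_lt_coe_iff.2 hs.2).trans hb))

lemma IsSolution.intervalIntegrable (hP : P.IsRegular lam) (hW : Bornology.IsBounded W)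
    (hw : PiecewiseContinuous w) (hwW : ∀ s : ℝ, 0 ≤ s → w s ∈ W) (ht : IsTriggerSeq t)
    (h : IsSolution P w u x₀ t x uhat T) {a b : ℝ} (ha : 0 ≤ a) (hab : a ≤ b)
    (hb : (b : EReal) < T) :
    IntervalIntegrable (fun s => P.rhs (uhat s) (x s) + w s) volume a b := by
  rw [intervalIntegrable_iff_integrableOn_Ico_of_le hab]
  exact (h.integrableOn hP hW hw hwW ht hb).mono_set (Ico_subset_Ico_left ha)

lemma IsSolution.sub_eq_integral (hP : P.IsRegular lam) (hW : Bornology.IsBounded W)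
    (hw : PiecewiseContinuous w) (hwW : ∀ s : ℝ, 0 ≤ s → w s ∈ W) (ht : IsTriggerSeq t)
    (h : IsSolution P w u x₀ t x uhat T) {a b : ℝ} (ha : 0 ≤ a) (hab : a ≤ b)
    (hb : (b : EReal) < T) :
    x b - x a = ∫ s in a..b, (P.rhs (uhat s) (x s) + w s) := by
  have haT : (a : EReal) < T := (EReal.coe_le_coe_iff.2 hab).trans_lt hb
  rw [h.eq_integral (ha.trans hab) hb, h.eq_integral ha haT, add_sub_add_left_eq_sub,
    intervalIntegral.integral_interval_sub_left]
  · exact h.intervalIntegrable hP hW hw hwW ht le_rfl (ha.trans hab) hb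
  · exact h.intervalIntegrable hP hW hw hwW ht le_rfl ha haT

/-- Solutions have right derivatives everywhere. -/
lemma IsSolution.exists_hasDerivWithinAt (hP : P.IsRegular lam) (hW : Bornology.IsBounded W)
    (hw : PiecewiseContinuous w) (hwW : ∀ s : ℝ, 0 ≤ s → w s ∈ W) (ht : IsTriggerSeq t)
    (h : IsSolution P w u x₀ t x uhat T) {s : ℝ} (hs : 0 ≤ s) (hsT : (s : EReal) < T) :
    ∃ v ∈ closure W, HasDerivWithinAt x (P.rhs (uhat s) (x s) + v) (Ici s) s := by
  obtain ⟨v, hv⟩ := hw.right_limit s hs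
  -- The right limit of the disturbance need not be one of its values, hence the closure.
  have hvW : v ∈ closure W := mem_closure_of_tendsto hv <|
    eventually_nhdsWithin_of_forall fun σ hσ => hwW σ (hs.trans (le_of_lt hσ))
  refine ⟨v, hvW, ?_⟩
  obtain ⟨i, hi, hi'⟩ := ht.exists_mem hs (hsT.trans_le h.T_le)
  obtain ⟨b, hsb, hb⟩ := EReal.lt_iff_exists_real_btwn.1 (lt_min hsT hi')
  have hsb' : s < b := by exact_mod_cast hsb
  have hbT : (b : EReal) < T := hb.trans_le (min_le_left _ _)
  have hbi : (b : EReal) < t (i + 1) := hb.trans_le (min_le_right _ _)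
  have hnear : Ioo s b ∈ 𝓝[>] s := Ioo_mem_nhdsGT hsb'
  have hconst : ∀ σ ∈ Ico s b, uhat σ = uhat s := by
    intro σ hσ
    have h1 : (σ : EReal) < b := by exact_mod_cast hσ.2
    have h2 : (s : EReal) ≤ σ := by exact_mod_cast hσ.1
    rw [h.hold i σ (hi.trans h2) (h1.trans hbi) (h1.trans hbT), h.hold i s hi hi' hsT]
  have hxs : Tendsto x (𝓝[>] s) (𝓝 (x s)) := by
    refine (h.continuousOn_Icc hbT s ⟨hs, hsb'.le⟩).mono_left ?_
    refine nhdsWithin_le_of_mem (mem_of_superset hnear fun σ hσ => ⟨hs.trans hσ.1.le, hσ.2.le⟩)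
  have hlim : Tendsto (fun σ => P.rhs (uhat σ) (x σ) + w σ) (𝓝[>] s)
      (𝓝 (P.rhs (uhat s) (x s) + v)) := by
    have h1 : Tendsto (fun σ => P.rhs (uhat s) (x σ) + w σ) (𝓝[>] s)
        (𝓝 (P.rhs (uhat s) (x s) + v)) :=
      (((hP.continuous_rhs (uhat s)).tendsto _).comp hxs).add hv
    refine h1.congr' ?_
    filter_upwards [hnear] with σ hσ
    rw [hconst σ ⟨hσ.1.le, hσ.2⟩]
  have hmeas : StronglyMeasurableAtFilter (fun σ => P.rhs (uhat σ) (x σ) + w σ) (𝓝[>] s) :=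
    ⟨Ioo s b, hnear, ((h.integrableOn hP hW hw hwW ht hbT).mono_set
      fun σ hσ => ⟨hs.trans hσ.1.le, hσ.2⟩).aestronglyMeasurable⟩
  have hder := intervalIntegral.integral_hasDerivWithinAt_of_tendsto_ae_right (s := Ici s)
    (h.intervalIntegrable hP hW hw hwW ht le_rfl hs hsT) hmeas (hlim.mono_left inf_le_left)
  refine (hder.const_add x₀).congr_of_eventuallyEq ?_ (h.eq_integral hs hsT)
  filter_upwards [Ico_mem_nhdsGE hsb'] with σ hσ
  exact h.eq_integral (hs.trans hσ.1) ((EReal.coe_lt_coe_iff.2 hσ.2).trans hbT)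

end Solution

/-! ### Local existence, continuation and maximal solutions -/

/-- A piecewise continuous function agrees, right after any instant, with a continuous one. -/
lemma PiecewiseContinuous.exists_continuousOn {n : ℕ} {w : ℝ → State n}
    (hw : PiecewiseContinuous w) {s : ℝ} (hs : 0 ≤ s) :
    ∃ v, Tendsto w (𝓝[>] s) (𝓝 v) ∧ ∃ τ > 0,
      ContinuousOn (fun σ => if σ ≤ s then v else w σ) (Icc s (s + τ)) := by
  obtain ⟨v, hv⟩ := hw.right_limit s hs
  refine ⟨v, hv, ?_⟩
  set D := {σ : ℝ | 0 ≤ σ ∧ σ ≤ s + 1 ∧ ¬ ContinuousWithinAt w (Ici 0) σ} with hD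
  have hDf : (D \ {s}).Finite := (hw.finite_disc (s + 1)).subset sdiff_subset
  -- Only finitely many discontinuities other than `s` are near, so a ball around `s` avoids them.
  obtain ⟨ε, hε, hball⟩ := Metric.mem_nhds_iff.1
    (hDf.isClosed.isOpen_compl.mem_nhds (show s ∈ (D \ {s})ᶜ from fun h => h.2 rfl))
  refine ⟨min (ε / 2) 1, by positivity, fun σ hσ => ?_⟩
  have hσ1 : σ ≤ s + ε / 2 := hσ.2.trans (by linarith [min_le_left (ε / 2) 1])
  have hσ2 : σ ≤ s + 1 := hσ.2.trans (by linarith [min_le_right (ε / 2) 1])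
  rcases hσ.1.eq_or_lt with rfl | hlt
  · have h1 : Tendsto (fun σ => if σ ≤ s then v else w σ) (𝓝[>] s) (𝓝 v) := by
      refine hv.congr' ?_
      filter_upwards [self_mem_nhdsWithin] with σ hσ
      rw [if_neg (not_le.2 hσ)]
    have h2 : ContinuousWithinAt (fun σ => if σ ≤ s then v else w σ) (Ioi s) s := by
      simpa [ContinuousWithinAt] using h1
    exact (continuousWithinAt_Ioi_iff_Ici.1 h2).mono Icc_subset_Ici_self
  · have hσD : σ ∉ D := fun h => by
      refine hball (?_ : σ ∈ Metric.ball s ε) ⟨h, hlt.ne'⟩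
      rw [Metric.mem_ball, Real.dist_eq, abs_of_pos (sub_pos.2 hlt)]
      linarith
    have hc : ContinuousWithinAt w (Ici 0) σ := by
      by_contra h
      exact hσD ⟨hs.trans hlt.le, hσ2, h⟩
    have hc' : ContinuousAt w σ := hc.continuousAt (Ici_mem_nhds (hs.trans_lt hlt))
    refine (hc'.congr ?_).continuousWithinAt
    filter_upwards [Ioi_mem_nhds hlt] with y hy
    rw [if_neg (not_le.2 hy)]

section Existence

variable {n m : ℕ} {P : Plant n m} {lam : ℝ} {W : Set (State n)} {w : ℝ → State n}
  {u : State n → ℝ → Fin m → ℝ} {x₀ : State n} {t : ℕ → EReal} {x : ℝ → State n}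
  {uhat : ℝ → Fin m → ℝ}

/-- Local solutions with a constant input. -/
lemma exists_local_solution (hP : P.IsRegular lam) (hW : Bornology.IsBounded W)
    (hw : PiecewiseContinuous w) (hwW : ∀ s : ℝ, 0 ≤ s → w s ∈ W) (c : Fin m → ℝ) {s : ℝ}
    (hs : 0 ≤ s) (xs : State n) :
    ∃ τ > 0, ∃ y : ℝ → State n, ContinuousOn y (Icc s (s + τ)) ∧ y s = xs ∧
      ∀ σ ∈ Icc s (s + τ), y σ = xs + ∫ σ' in s..σ, (P.rhs c (y σ') + w σ') := by
  obtain ⟨v, hv, τ₁, hτ₁, hcont⟩ := hw.exists_continuousOn hs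
  obtain ⟨K, U, hU, hKU⟩ := hP.locallyLipschitz_rhs c xs
  obtain ⟨a, ha, haU⟩ := Metric.nhds_basis_closedBall.mem_iff.1 hU
  obtain ⟨M, hM⟩ := (isCompact_closedBall xs a).exists_bound_of_continuousOn
    (hP.continuous_rhs c).continuousOn
  obtain ⟨B, hB⟩ := hW.exists_norm_le
  -- Replacing w at `s` by its right limit gives the continuity in time that Picard–Lindelöf needs
  -- and leaves the integrals unchanged.
  set q : ℝ → State n := fun σ => if σ ≤ s then v else w σ with hq
  have hqB : ∀ σ, ‖q σ‖ ≤ B := by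
    intro σ
    by_cases hσ : σ ≤ s
    · simp only [hq, if_pos hσ]
      refine le_of_tendsto hv.norm (eventually_nhdsWithin_of_forall fun y hy => ?_)
      exact hB _ (hwW y (hs.trans (le_of_lt hy)))
    · simp only [hq, if_neg hσ]
      exact hB _ (hwW σ (hs.trans (not_le.1 hσ).le))
  set L : ℝ := |M| + |B| + 1 with hL
  have hL0 : 0 < L := by positivity
  -- At speed at most `L` the solution stays for this time in the ball of radius `a` where the field
  -- is Lipschitz.
  set τ := min τ₁ (a / L) with hτ
  have hτ0 : 0 < τ := lt_min hτ₁ (by positivity)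
  have hpl : IsPicardLindelof (fun σ y => P.rhs c y + q σ) (tmin := s) (tmax := s + τ)
      ⟨s, le_rfl, by linarith⟩ xs (.mk a ha.le) 0 (.mk L hL0.le) K := by
    refine ⟨fun σ _ => ?_, fun y _ => ?_, fun σ _ y hy => ?_, ?_⟩
    · intro y hy z hz
      simpa using hKU (haU hy) (haU hz)
    · refine continuousOn_const.add (hcont.mono (Icc_subset_Icc_right ?_))
      linarith [min_le_left τ₁ (a / L)]
    · refine (norm_add_le _ _).trans ?_
      have := hM y hy
      have := hqB σ
      change _ ≤ L
      linarith [le_abs_self M, le_abs_self B]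
    · change L * max (s + τ - s) (s - s) ≤ a - 0
      rw [sub_self, add_sub_cancel_left, max_eq_left hτ0.le, sub_zero, ← le_div_iff₀' hL0]
      exact min_le_right _ _
  obtain ⟨y, hys, hy⟩ := hpl.exists_eq_forall_mem_Icc_hasDerivWithinAt₀
  have hyc : ContinuousOn y (Icc s (s + τ)) := HasDerivWithinAt.continuousOn hy
  refine ⟨τ, hτ0, y, hyc, hys, fun σ hσ => ?_⟩
  have hsub : Icc s σ ⊆ Icc s (s + τ) := Icc_subset_Icc_right hσ.2
  have hFc : ContinuousOn (fun σ' => P.rhs c (y σ') + q σ') (Icc s σ) :=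
    ((hP.continuous_rhs c).comp_continuousOn (hyc.mono hsub)).add
      (hcont.mono (Icc_subset_Icc_right (by linarith [hσ.2, min_le_left τ₁ (a / L)])))
  have hint := intervalIntegral.integral_eq_sub_of_hasDeriv_right_of_le hσ.1 (hyc.mono hsub)
    (fun σ' hσ' => ((hy σ' (hsub (Ioo_subset_Icc_self hσ'))).hasDerivAt
      (Icc_mem_nhds hσ'.1 (hσ'.2.trans_le hσ.2))).hasDerivWithinAt)
    (hFc.intervalIntegrable_of_Icc hσ.1)
  have hcongr : ∫ σ' in s..σ, (P.rhs c (y σ') + w σ') = ∫ σ' in s..σ, (P.rhs c (y σ') + q σ') := by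
    refine intervalIntegral.integral_congr_Ioo_of_le hσ.1 fun σ' hσ' => ?_
    simp only [hq, if_neg (not_le.2 hσ'.1)]
  rw [hcongr, hint, hys]
  abel

/-- A solution on a closed interval that ends before `sup tᵢ` can be continued. -/
lemma exists_continuation (hP : P.IsRegular lam) (hW : Bornology.IsBounded W)
    (hw : PiecewiseContinuous w) (hwW : ∀ s : ℝ, 0 ≤ s → w s ∈ W) (ht : IsTriggerSeq t) {b : ℝ}
    (hb0 : 0 ≤ b) (hb : (b : EReal) < ⨆ i, t i) (hx : ContinuousOn x (Icc 0 b))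
    (hhold : ∀ (i : ℕ) (s : ℝ), t i ≤ (s : EReal) → (s : EReal) < t (i + 1) → s < b →
      uhat s = u (x (t i).toReal) (t i).toReal)
    (hdyn : ∀ s ∈ Icc 0 b, x s = x₀ + ∫ σ in (0 : ℝ)..s, (P.rhs (uhat σ) (x σ) + w σ)) :
    ∃ x' uhat' T', IsSolution P w u x₀ t x' uhat' T' ∧ (b : EReal) < T' ∧
      ∀ s ∈ Icc 0 b, x' s = x s := by
  classical
  obtain ⟨i, hi, hi'⟩ := ht.exists_mem hb0 hb
  set c := u (x (t i).toReal) (t i).toReal with hc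
  obtain ⟨τ, hτ, y, hyc, hyb, hy⟩ := exists_local_solution hP hW hw hwW c hb0 (x b)
  set x' : ℝ → State n := fun s => if s ≤ b then x s else y s with hx'
  -- The inequality is strict because `b` may itself be a triggering instant, where the input
  -- already has its new value.
  set uhat' : ℝ → Fin m → ℝ := fun s => if s < b then uhat s else c with hu'
  have ex : ∀ s, s ≤ b → x' s = x s := fun s hs => if_pos hs
  have ey : ∀ s, b ≤ s → x' s = y s := fun s hs => by
    rcases hs.eq_or_lt with rfl | h
    · rw [ex b le_rfl, hyb]
    · exact if_neg (not_le.2 h)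
  obtain ⟨R, hR⟩ := (isCompact_Icc (a := (0 : ℝ)) (b := b)).exists_bound_of_continuousOn hx
  have hcont : ContinuousOn x' (Icc 0 (b + τ)) := by
    have h1 : ContinuousOn x' (Icc 0 b) := hx.congr fun s hs => ex s hs.2
    have h2 : ContinuousOn x' (Icc b (b + τ)) := hyc.congr fun s hs => ey s hs.1
    have := h1.union_of_isClosed h2 isClosed_Icc isClosed_Icc
    rwa [Icc_union_Icc_eq_Icc hb0 (by linarith)] at this
  have hleft : ∀ s ∈ Icc 0 b, ∫ σ in (0 : ℝ)..s, (P.rhs (uhat' σ) (x' σ) + w σ) =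
      ∫ σ in (0 : ℝ)..s, (P.rhs (uhat σ) (x σ) + w σ) := fun s hs => by
    refine intervalIntegral.integral_congr_Ioo_of_le hs.1 fun σ hσ => ?_
    have hσb := hσ.2.trans_le hs.2
    simp only [ex σ hσb.le, hu', if_pos hσb]
  have hright : ∀ s, b ≤ s → ∫ σ in b..s, (P.rhs (uhat' σ) (x' σ) + w σ) =
      ∫ σ in b..s, (P.rhs c (y σ) + w σ) := fun s hs => by
    refine intervalIntegral.integral_congr_Ioo_of_le hs fun σ hσ => ?_
    simp only [ey σ hσ.1.le, hu', if_neg (not_lt.2 hσ.1.le)]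
  have hhold' : ∀ (j : ℕ) (s : ℝ), t j ≤ (s : EReal) → (s : EReal) < t (j + 1) →
      (s : EReal) < t (i + 1) → uhat' s = u (x' (t j).toReal) (t j).toReal := by
    intro j s h1 h2 h3
    by_cases hsb : s < b
    · rw [ex _ ((ht.toReal_mem h1).2.trans hsb.le)]
      simp only [hu', if_pos hsb]
      exact hhold j s h1 h2 hsb
    · have hbs : (b : EReal) ≤ s := by exact_mod_cast not_lt.1 hsb
      have hij : j = i := le_antisymm (ht.le_of_le_of_lt h1 h3)
        (ht.le_of_le_of_lt (hi.trans hbs) h2)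
      subst hij
      rw [ex _ (ht.toReal_mem hi).2]
      simp only [hu', if_neg hsb, hc]
  -- The continuation stops no later than the next event, up to which the input `c` is held.
  have hlt : (b : EReal) < min ((b + τ : ℝ) : EReal) (t (i + 1)) :=
    lt_min (by exact_mod_cast (by linarith : b < b + τ)) hi'
  have hle : ∀ s : ℝ, (s : EReal) < min ((b + τ : ℝ) : EReal) (t (i + 1)) →
      s ≤ b + τ ∧ (s : EReal) < t (i + 1) := fun s hs =>
    ⟨by exact_mod_cast (hs.trans_le (min_le_left _ _)).le, hs.trans_le (min_le_right _ _)⟩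
  have hsup : min ((b + τ : ℝ) : EReal) (t (i + 1)) ≤ ⨆ i, t i :=
    (min_le_right _ _).trans (le_iSup t (i + 1))
  have hint : ∀ s : ℝ, 0 ≤ s → (s : EReal) < min ((b + τ : ℝ) : EReal) (t (i + 1)) →
      IntegrableOn (fun σ => P.rhs (uhat' σ) (x' σ) + w σ) (Ico 0 s) := by
    intro s _ hs
    obtain ⟨R', hR'⟩ := (isCompact_Icc (a := (0 : ℝ)) (b := s)).exists_bound_of_continuousOn
      (hcont.mono (Icc_subset_Icc_right (hle s hs).1))
    refine integrableOn_dynamics hP hW hw hwW ht (hs.trans_le hsup)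
      (hcont.mono fun σ hσ => ⟨hσ.1, hσ.2.le.trans (hle s hs).1⟩)
      (fun σ hσ => hR' σ ⟨hσ.1, hσ.2.le⟩)
      (fun j σ hσ h1 h2 => hhold' j σ h1 h2 ((EReal.coe_lt_coe_iff.2 hσ.2).trans (hle s hs).2))
  refine ⟨x', uhat', _, ⟨?_, hsup, fun j s h1 h2 h3 => hhold' j s h1 h2 (hle s h3).2, ?_, ?_⟩,
    hlt, fun s hs => ex s hs.2⟩
  · exact lt_of_le_of_lt (by exact_mod_cast hb0) hlt
  · exact hcont.mono fun s hs => ⟨hs.1, (hle s hs.2).1⟩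
  · intro s hs0 hs
    change x' s = x₀ + ∫ σ in (0 : ℝ)..s, (P.rhs (uhat' σ) (x' σ) + w σ)
    rcases le_total s b with hsb | hbs
    · rw [hleft s ⟨hs0, hsb⟩, ex s hsb, hdyn s ⟨hs0, hsb⟩]
    · have hii : IntervalIntegrable (fun σ => P.rhs (uhat' σ) (x' σ) + w σ) volume 0 s := by
        rw [intervalIntegrable_iff_integrableOn_Ico_of_le hs0]
        exact hint s hs0 hs
      have hmem : b ∈ uIcc 0 s := by
        rw [uIcc_of_le hs0]
        exact ⟨hb0, hbs⟩
      rw [← intervalIntegral.integral_add_adjacent_intervals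
        (hii.mono_set (uIcc_subset_uIcc_left hmem)) (hii.mono_set (uIcc_subset_uIcc_right hmem)),
        hleft b ⟨hb0, le_rfl⟩, hright s hbs, ← add_assoc, ← hdyn b ⟨hb0, le_rfl⟩, ey s hbs]
      exact hy s ⟨hbs, (hle s hs).1⟩

/-- The union of a chain of solutions, ordered by continuation, is a solution. -/
lemma exists_solution_of_isChain (S : Set ((ℝ → State n) × (ℝ → Fin m → ℝ) × EReal))
    (hS : ∀ p ∈ S, IsSolution P w u x₀ t p.1 p.2.1 p.2.2) (hne : S.Nonempty)
    (ht : IsTriggerSeq t)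
    (hchain : ∀ p ∈ S, ∀ q ∈ S, ∀ s : ℝ, 0 ≤ s → (s : EReal) < p.2.2 → (s : EReal) < q.2.2 →
      p.1 s = q.1 s) :
    ∃ x' uhat' T', IsSolution P w u x₀ t x' uhat' T' ∧
      ∀ p ∈ S, p.2.2 ≤ T' ∧ ∀ s : ℝ, 0 ≤ s → (s : EReal) < p.2.2 → x' s = p.1 s := by
  classical
  set T' : EReal := ⨆ p ∈ S, p.2.2 with hT'
  have hex : ∀ s : ℝ, (s : EReal) < T' → ∃ p ∈ S, (s : EReal) < p.2.2 := fun s hs => by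
    simpa [hT', lt_iSup_iff] using hs
  choose! c hcS hcs using hex
  have hle : ∀ p ∈ S, p.2.2 ≤ T' := fun p hp => le_iSup₂_of_le p hp le_rfl
  have key : ∀ p ∈ S, ∀ s : ℝ, 0 ≤ s → (s : EReal) < p.2.2 → (c s).1 s = p.1 s :=
    fun p hp s hs0 hs => hchain _ (hcS s (hs.trans_le (hle p hp))) p hp s hs0
      (hcs s (hs.trans_le (hle p hp))) hs
  -- Held inputs are determined by past samples of the state, so it suffices that the states agree
  -- along the chain.
  have keyu : ∀ p ∈ S, ∀ s : ℝ, 0 ≤ s → (s : EReal) < p.2.2 →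
      (c s).2.1 s = p.2.1 s := fun p hp s hs0 hs => by
    have hsT := hs.trans_le (hle p hp)
    obtain ⟨i, hi, hi'⟩ := ht.exists_mem hs0 (hs.trans_le (hS p hp).T_le)
    rw [(hS _ (hcS s hsT)).hold i s hi hi' (hcs s hsT), (hS p hp).hold i s hi hi' hs]
    obtain ⟨h1, h2⟩ := ht.toReal_mem hi
    have h3 : (((t i).toReal : ℝ) : EReal) ≤ s := by exact_mod_cast h2
    rw [hchain _ (hcS s hsT) p hp _ h1 (h3.trans_lt (hcs s hsT)) (h3.trans_lt hs)]
  refine ⟨fun s => (c s).1 s, fun s => (c s).2.1 s, T', ⟨?_, ?_, ?_, ?_, ?_⟩,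
    fun p hp => ⟨hle p hp, key p hp⟩⟩
  · obtain ⟨p, hp⟩ := hne
    exact (hS p hp).T_pos.trans_le (hle p hp)
  · exact iSup₂_le fun p hp => (hS p hp).T_le
  · intro i s hi hi' hs
    have h := (hS _ (hcS s hs)).hold i s hi hi' (hcs s hs)
    obtain ⟨h1, h2⟩ := ht.toReal_mem hi
    have h3 : (((t i).toReal : ℝ) : EReal) ≤ s := by exact_mod_cast h2
    simp only [h, key _ (hcS s hs) _ h1 (h3.trans_lt (hcs s hs))]
  · intro s hs
    have hp := hcS s hs.2
    have hsp := hcs s hs.2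
    obtain ⟨b, hsb, hb⟩ := EReal.lt_iff_exists_real_btwn.1 hsp
    have hsb' : s < b := by exact_mod_cast hsb
    have hcw := (hS _ hp).continuousOn_Icc hb s ⟨hs.1, hsb'.le⟩
    refine ((hcw.congr (g := fun s => (c s).1 s) (fun σ hσ => key _ hp σ hσ.1
      ((EReal.coe_le_coe_iff.2 hσ.2).trans_lt hb)) rfl)).mono_of_mem_nhdsWithin ?_
    filter_upwards [self_mem_nhdsWithin, mem_nhdsWithin_of_mem_nhds (Iio_mem_nhds hsb')]
      with σ h1 h2
    exact ⟨h1.1, le_of_lt h2⟩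
  · intro s hs0 hs
    have hp := hcS s hs
    refine ((hS _ hp).dynamics s hs0 (hcs s hs)).trans ?_
    congr 1
    refine intervalIntegral.integral_congr fun σ hσ => ?_
    rw [uIcc_of_le hs0] at hσ
    have hσp : (σ : EReal) < (c s).2.2 := (EReal.coe_le_coe_iff.2 hσ.2).trans_lt (hcs s hs)
    simp only [key _ hp σ hσ.1 hσp, keyu _ hp σ hσ.1 hσp]

/-- Maximal solutions exist, for any feedback law. -/
theorem exists_isMaximalSolution (hP : P.IsRegular lam) (hW : Bornology.IsBounded W)
    (hw : PiecewiseContinuous w) (hwW : ∀ s : ℝ, 0 ≤ s → w s ∈ W) (ht : IsTriggerSeq t)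
    (u : State n → ℝ → Fin m → ℝ) (x₀ : State n) :
    ∃ x uhat T, IsMaximalSolution P w u x₀ t x uhat T := by
  let Sol := {p : (ℝ → State n) × (ℝ → Fin m → ℝ) × EReal //
    IsSolution P w u x₀ t p.1 p.2.1 p.2.2}
  let r : Sol → Sol → Prop := fun p q =>
    p.1.2.2 ≤ q.1.2.2 ∧ ∀ s : ℝ, 0 ≤ s → (s : EReal) < p.1.2.2 → q.1.1 s = p.1.1 s
  have hsup : ((0 : ℝ) : EReal) < ⨆ i, t i := by
    have h0 : t 0 < t 1 := ht.lt_succ 0 (by simp [ht.zero])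
    rw [ht.zero] at h0
    exact lt_of_lt_of_le (by exact_mod_cast h0) (le_iSup t 1)
  -- Continuing the constant curve on [0, 0], where the hold condition is vacuous, gives a first
  -- solution for Zorn's lemma.
  obtain ⟨x₁, u₁, T₁, h₁, -, -⟩ := exists_continuation (x := fun _ => x₀) (x₀ := x₀) (u := u)
    (uhat := fun _ => 0) hP hW hw hwW ht le_rfl hsup continuousOn_const
    (fun i s hi _ hs => absurd hs (not_lt.2 ((ht.toReal_mem hi).1.trans (ht.toReal_mem hi).2)))
    (fun s hs => by
      have : s = 0 := le_antisymm hs.2 hs.1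
      simp [this])
  have : Nonempty Sol := ⟨⟨(x₁, u₁, T₁), h₁⟩⟩
  obtain ⟨p, hp⟩ := exists_maximal_of_nonempty_chains_bounded (r := r)
    (fun c hc hne => by
      obtain ⟨x', u', T', h', hext⟩ := exists_solution_of_isChain (Subtype.val '' c)
        (by rintro _ ⟨p, -, rfl⟩; exact p.2) (hne.image _) ht (by
          rintro _ ⟨p, hp, rfl⟩ _ ⟨q, hq, rfl⟩ s hs0 hsp hsq
          rcases eq_or_ne p q with rfl | hpq
          · rfl
          · rcases hc hp hq hpq with h | h
            · exact (h.2 s hs0 hsp).symm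
            · exact h.2 s hs0 hsq)
      exact ⟨⟨(x', u', T'), h'⟩, fun p hp => hext p.1 ⟨p, hp, rfl⟩⟩)
    (fun {a b c} hab hbc => ⟨hab.1.trans hbc.1, fun s hs0 hs => by
      rw [hbc.2 s hs0 (hs.trans_le hab.1), hab.2 s hs0 hs]⟩)
  refine ⟨p.1.1, p.1.2.1, p.1.2.2, p.2, fun x' u' T' h' hag => ?_⟩
  by_contra hlt
  have hlt' := (not_le.1 hlt).le
  exact hlt (hp ⟨(x', u', T'), h'⟩ ⟨hlt', fun s hs0 hs => hag s hs0 hs (hs.trans_le hlt')⟩).1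

end Existence

/-! ### The transformed error -/

/-- This number is the value of ξ at which the transformed error equals `M`; it serves as a barrier.
-/
lemma neg_one_div_one_add_exp_mem (M : ℝ) : -1 / (1 + Real.exp M) ∈ Ioo (-1 : ℝ) 0 := by
  have := Real.exp_pos M
  refine ⟨?_, div_neg_of_neg_of_pos (by norm_num) (by linarith)⟩
  rw [lt_div_iff₀ (by linarith)]
  linarith

/-- The transformation ξ ↦ ε increases on (-1, 0), with inverse M ↦ -1/(1 + exp M). -/
lemma log_neg_div_le_iff {ξ : ℝ} (hξ : ξ ∈ Ioo (-1 : ℝ) 0) (M : ℝ) :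
    Real.log (-((ξ + 1) / ξ)) ≤ M ↔ ξ ≤ -1 / (1 + Real.exp M) := by
  have h1 : 0 < -ξ := neg_pos.2 hξ.2
  have h2 : -((ξ + 1) / ξ) = (ξ + 1) / -ξ := by rw [div_neg]
  have h3 : 0 < (ξ + 1) / -ξ := div_pos (by linarith [hξ.1]) h1
  have := Real.exp_pos M
  rw [h2, Real.log_le_iff_le_exp h3, div_le_iff₀ h1, le_div_iff₀ (by linarith)]
  constructor <;> intro h <;> nlinarith

lemma le_log_neg_div_iff {ξ : ℝ} (hξ : ξ ∈ Ioo (-1 : ℝ) 0) (M : ℝ) :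
    M ≤ Real.log (-((ξ + 1) / ξ)) ↔ -1 / (1 + Real.exp M) ≤ ξ := by
  have h1 : 0 < -ξ := neg_pos.2 hξ.2
  have h2 : -((ξ + 1) / ξ) = (ξ + 1) / -ξ := by rw [div_neg]
  have h3 : 0 < (ξ + 1) / -ξ := div_pos (by linarith [hξ.1]) h1
  have := Real.exp_pos M
  rw [h2, Real.le_log_iff_exp_le h3, le_div_iff₀ h1, div_le_iff₀ (by linarith)]
  constructor <;> intro h <;> nlinarith

/-! ### The funnel estimate -/

section Funnel

variable {n m : ℕ} {P : Plant n m} {lam : ℝ} {W : Set (State n)} {w : ℝ → State n} {d : Design}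
  {η : ℝ} {φ : Temporal n} {x₀ : State n} {t : ℕ → EReal} {x : ℝ → State n}
  {uhat : ℝ → Fin m → ℝ} {T : EReal} {k₁ k₂ k₃ δu : ℝ} {ψ : NonTemporal n}

/-- The drift bound persists for limits of disturbance values. -/
lemma IsGain.drift_closure (hk : IsGain P lam W d η ψ k₁ k₂ k₃) {y : State n}
    (hy : y ∈ d.stateSet η ψ) {v : State n} (hv : v ∈ closure W) {ξ : ℝ}
    (hξ : ξ ∈ Ioo (-1 : ℝ) 0) {s : ℝ} (hs : 0 ≤ s) :
    |inner ℝ (gradient (ψ.robR η) y) (P.f y + v) - ξ * deriv d.perf s| ≤ k₁ := by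
  have hcl : IsClosed {v : State n |
      |inner ℝ (gradient (ψ.robR η) y) (P.f y + v) - ξ * deriv d.perf s| ≤ k₁} :=
    isClosed_le (by fun_prop) continuous_const
  exact closure_minimal (fun v hv => hk.drift y hy v hv ξ hξ s hs) hcl hv

lemma inner_gradient_mulVec (P : Plant n m) (η : ℝ) (ψ : NonTemporal n) (y : State n)
    (c : Fin m → ℝ) :
    inner ℝ (gradient (ψ.robR η) y) (WithLp.toLp 2 (P.g y *ᵥ c)) = P.inputGrad η ψ y ⬝ᵥ c := by
  rw [Plant.inputGrad, EuclideanSpace.inner_eq_star_dotProduct, Matrix.mulVec_transpose,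
    ← Matrix.dotProduct_mulVec, star_trivial, dotProduct_comm]

/-- The input matrix damps along the gradient. -/
lemma IsGain.le_inputGrad_dotProduct (hP : P.IsRegular lam)
    (hk : IsGain P lam W d η ψ k₁ k₂ k₃) {y : State n} (hy : y ∈ d.stateSet η ψ) :
    k₂ ≤ P.inputGrad η ψ y ⬝ᵥ P.inputGrad η ψ y := by
  refine (hk.damping y hy).trans ((hP.posDef y _).trans_eq ?_)
  rw [Plant.inputGrad, ← Matrix.mulVec_mulVec, Matrix.dotProduct_mulVec, ← Matrix.mulVec_transpose]

/-- This is Hölder's inequality between the sum norm of the row and the maximum norm, in which the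
sampling error is measured. -/
lemma IsGain.abs_inputGrad_dotProduct_le (hk : IsGain P lam W d η ψ k₁ k₂ k₃) {y : State n}
    (hy : y ∈ d.stateSet η ψ) (e : Fin m → ℝ) :
    |P.inputGrad η ψ y ⬝ᵥ e| ≤ k₃ * ‖e‖ := by
  calc |P.inputGrad η ψ y ⬝ᵥ e| ≤ ∑ j, |P.inputGrad η ψ y j * e j| :=
        Finset.abs_sum_le_sum_abs _ _
    _ ≤ ∑ j, |P.inputGrad η ψ y j| * ‖e‖ := by
        refine Finset.sum_le_sum fun j _ => ?_
        rw [abs_mul]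
        exact mul_le_mul_of_nonneg_left (norm_le_pi_norm e j) (abs_nonneg _)
    _ = (∑ j, |P.inputGrad η ψ y j|) * ‖e‖ := by rw [Finset.sum_mul]
    _ ≤ k₃ * ‖e‖ := mul_le_mul_of_nonneg_right (hk.input y hy) (norm_nonneg _)

/-- The part of the derivative of `ξ`, multiplied by `γ`, that does not stem from the damping
term, is at most `k₁ + k₃ δᵤ`. -/
lemma IsGain.abs_drift_add_damping_le (hk : IsGain P lam W d η ψ k₁ k₂ k₃) {y : State n}
    {s : ℝ} (hs : 0 ≤ s) (hy : y ∈ d.stateSet η ψ) (hξ : d.normErr η ψ y s ∈ Ioo (-1 : ℝ) 0)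
    {v : State n} (hv : v ∈ closure W) {c : Fin m → ℝ} (hc : ‖P.feedback d η ψ y s - c‖ ≤ δu) :
    |inner ℝ (gradient (ψ.robR η) y) (P.rhs c y + v) - d.normErr η ψ y s * deriv d.perf s +
      d.transErr η ψ y s * (P.inputGrad η ψ y ⬝ᵥ P.inputGrad η ψ y)| ≤ k₁ + k₃ * δu := by
  have h1 := hk.drift_closure hy hv hξ hs
  have h2 : |P.inputGrad η ψ y ⬝ᵥ (P.feedback d η ψ y s - c)| ≤ k₃ * δu :=
    (hk.abs_inputGrad_dotProduct_le hy _).trans (mul_le_mul_of_nonneg_left hc hk.k₃_pos.le)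
  have h3 : inner ℝ (gradient (ψ.robR η) y) (P.rhs c y + v) =
      inner ℝ (gradient (ψ.robR η) y) (P.f y + v) + P.inputGrad η ψ y ⬝ᵥ c := by
    rw [Plant.rhs, inner_add_right, inner_add_right, inner_add_right, inner_gradient_mulVec]
    ring
  have h4 : P.inputGrad η ψ y ⬝ᵥ (P.feedback d η ψ y s - c) =
      -d.transErr η ψ y s * (P.inputGrad η ψ y ⬝ᵥ P.inputGrad η ψ y) -
        P.inputGrad η ψ y ⬝ᵥ c := by
    rw [Plant.feedback, dotProduct_sub, dotProduct_smul, smul_eq_mul]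
  rw [h4] at h2
  rw [h3]
  rw [abs_le] at h1 h2 ⊢
  constructor <;> linarith [h1.1, h1.2, h2.1, h2.2]

/-- The right derivative of the normalized error along a solution. -/
lemma IsSolution.exists_hasDerivWithinAt_normErr (hP : P.IsRegular lam)
    (hW : Bornology.IsBounded W) (hw : PiecewiseContinuous w) (hwW : ∀ s : ℝ, 0 ≤ s → w s ∈ W)
    (hη : 0 < η) (hd : d.Admissible η φ x₀) (ht : IsTriggerSeq t)
    {u : State n → ℝ → Fin m → ℝ} (h : IsSolution P w u x₀ t x uhat T) {s : ℝ} (hs : 0 ≤ s)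
    (hsT : (s : EReal) < T) :
    ∃ v ∈ closure W, HasDerivWithinAt (fun σ => d.normErr η φ.body (x σ) σ)
      ((inner ℝ (gradient (φ.body.robR η) (x s)) (P.rhs (uhat s) (x s) + v) -
        d.normErr η φ.body (x s) s * deriv d.perf s) / d.perf s) (Ici s) s := by
  obtain ⟨v, hv, hder⟩ := h.exists_hasDerivWithinAt hP hW hw hwW ht hs hsT
  refine ⟨v, hv, ?_⟩
  have hψ := (NonTemporal.contDiff_robR hη hd.rob_ne_top).1.differentiable one_ne_zero (x s)
  have h1 : HasDerivWithinAt (fun σ => φ.body.robR η (x σ))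
      (inner ℝ (gradient (φ.body.robR η) (x s)) (P.rhs (uhat s) (x s) + v)) (Ici s) s := by
    rw [inner_gradient_left]
    exact hψ.hasFDerivAt.comp_hasDerivWithinAt s hder
  have hγ := (hd.perf_pos s).ne'
  have h2 : HasDerivWithinAt d.perf (deriv d.perf s) (Ici s) s :=
    (d.hasDerivAt_perf s).differentiableAt.hasDerivAt.hasDerivWithinAt
  refine ((h1.sub_const d.ρmax).div h2 hγ).congr_deriv ?_
  rw [Design.normErr]
  field_simp

/-- The normalized error stays strictly inside `(-1, 0)`, at a distance from the boundary given by
any bound on the transformed error that exceeds its initial value and `(k₁ + k₃ δᵤ) / k₂`. -/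
lemma IsSolution.normErr_mem_Icc (hP : P.IsRegular lam) (hW : Bornology.IsBounded W)
    (hw : PiecewiseContinuous w) (hwW : ∀ s : ℝ, 0 ≤ s → w s ∈ W) (hη : 0 < η)
    (hd : d.Admissible η φ x₀) (ht : IsTriggerSeq t)
    (h : IsSolution P w (P.feedback d η φ.body) x₀ t x uhat T)
    (hu : ∀ s : ℝ, 0 ≤ s → (s : EReal) < T → ‖P.feedback d η φ.body (x s) s - uhat s‖ ≤ δu)
    (hk : IsGain P lam W d η φ.body k₁ k₂ k₃) {M : ℝ}
    (hM₀ : |d.transErr η φ.body (x 0) 0| < M) (hM : (k₁ + k₃ * δu) / k₂ < M) {s : ℝ}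
    (hs : 0 ≤ s) (hsT : (s : EReal) < T) :
    d.normErr η φ.body (x s) s ∈ Icc (-1 / (1 + Real.exp (-M))) (-1 / (1 + Real.exp M)) := by
  have hM0 : 0 < M := (abs_nonneg _).trans_lt hM₀
  have hMk : k₁ + k₃ * δu < M * k₂ := (div_lt_iff₀ hk.k₂_pos).1 hM
  have hinit : d.normErr η φ.body (x 0) 0 ∈ Ioo (-1 : ℝ) 0 := by
    rw [h.initial]
    exact hd.normErr_init hη
  have hε := abs_lt.1 hM₀
  have hcont : ContinuousOn (fun σ => d.normErr η φ.body (x σ) σ) (Icc 0 s) := by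
    refine ContinuousOn.div ?_ ?_ fun σ _ => (hd.perf_pos σ).ne'
    · exact ((NonTemporal.contDiff_robR hη hd.rob_ne_top).1.continuous.comp_continuousOn
        (h.continuousOn_Icc hsT)).sub continuousOn_const
    · exact fun σ _ => (d.hasDerivAt_perf σ).continuousAt.continuousWithinAt
  have hlt : ∀ σ ∈ Ico 0 s, (σ : EReal) < T := fun σ hσ =>
    (EReal.coe_lt_coe_iff.2 hσ.2).trans hsT
  choose! v hv hder using fun σ (hσ : σ ∈ Ico 0 s) =>
    h.exists_hasDerivWithinAt_normErr hP hW hw hwW hη hd ht hσ.1 (hlt σ hσ)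
  -- These bounds are conditional on ξ lying in (-1, 0). They are used only at contact with a
  -- barrier, where this holds automatically.
  have hbd : ∀ σ ∈ Ico 0 s, d.normErr η φ.body (x σ) σ ∈ Ioo (-1 : ℝ) 0 → _ := fun σ hσ hξ =>
    hk.abs_drift_add_damping_le hσ.1 (hd.mem_stateSet_of_normErr hσ.1 hξ) hξ (hv σ hσ)
      (hu σ hσ.1 (hlt σ hσ))
  have hdamp : ∀ σ ∈ Ico 0 s, d.normErr η φ.body (x σ) σ ∈ Ioo (-1 : ℝ) 0 → _ := fun σ hσ hξ =>
    hk.le_inputGrad_dotProduct hP (hd.mem_stateSet_of_normErr hσ.1 hξ)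
  constructor
  · have hneg := image_le_of_deriv_right_lt_deriv_boundary (B := fun _ => 1 / (1 + Real.exp (-M)))
      (B' := fun _ => 0) hcont.neg (fun σ hσ => (hder σ hσ).neg) ?_
      (fun σ => hasDerivAt_const σ _) ?_ (right_mem_Icc.2 hs)
    · simp only [Pi.neg_apply] at hneg
      rw [neg_div]
      linarith
    · have := (le_log_neg_div_iff hinit (-M)).1 hε.1.le
      simp only [Pi.neg_apply]
      rw [neg_div] at this
      linarith
    · intro σ hσ heq
      have heq' : d.normErr η φ.body (x σ) σ = -1 / (1 + Real.exp (-M)) := by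
        rw [neg_div, ← heq, Pi.neg_apply, neg_neg]
      have hξ : d.normErr η φ.body (x σ) σ ∈ Ioo (-1 : ℝ) 0 :=
        heq' ▸ neg_one_div_one_add_exp_mem _
      have hle : d.transErr η φ.body (x σ) σ ≤ -M := (log_neg_div_le_iff hξ _).2 heq'.le
      have h1 := (abs_le.1 (hbd σ hσ hξ)).1
      have h2 := hdamp σ hσ hξ
      have h3 := hk.k₂_pos
      rw [neg_lt_zero]
      refine div_pos ?_ (hd.perf_pos σ)
      -- Since ε ≤ -M, the damping contributes at least M k₂, which exceeds the drift bound k₁ + k₃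
      -- δ_u.
      nlinarith
  · refine image_le_of_deriv_right_lt_deriv_boundary (B := fun _ => -1 / (1 + Real.exp M))
      (B' := fun _ => 0) hcont hder ((log_neg_div_le_iff hinit M).1 hε.2.le)
      (fun σ => hasDerivAt_const σ _) ?_ (right_mem_Icc.2 hs)
    intro σ hσ heq
    have hξ : d.normErr η φ.body (x σ) σ ∈ Ioo (-1 : ℝ) 0 := heq ▸ neg_one_div_one_add_exp_mem _
    have hle : M ≤ d.transErr η φ.body (x σ) σ := (le_log_neg_div_iff hξ _).2 heq.ge
    have h1 := (abs_le.1 (hbd σ hσ hξ)).2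
    have h2 := hdamp σ hσ hξ
    have h3 := hk.k₂_pos
    refine div_neg_of_neg_of_pos ?_ (hd.perf_pos σ)
    nlinarith

/-- The funnel is invariant and the transformed error is bounded. -/
theorem IsSolution.normErr_mem_and_abs_transErr_le (hP : P.IsRegular lam)
    (hW : Bornology.IsBounded W) (hw : PiecewiseContinuous w)
    (hwW : ∀ s : ℝ, 0 ≤ s → w s ∈ W) (hη : 0 < η) (hd : d.Admissible η φ x₀)
    (ht : IsTriggerSeq t) (h : IsSolution P w (P.feedback d η φ.body) x₀ t x uhat T)
   
    (hu : ∀ s : ℝ, 0 ≤ s → (s : EReal) < T → ‖P.feedback d η φ.body (x s) s - uhat s‖ ≤ δu)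
    (hk : IsGain P lam W d η φ.body k₁ k₂ k₃) {s : ℝ} (hs : 0 ≤ s) (hsT : (s : EReal) < T) :
    d.normErr η φ.body (x s) s ∈ Ioo (-1 : ℝ) 0 ∧
      |d.transErr η φ.body (x s) s| ≤
        max |d.transErr η φ.body (x 0) 0| ((k₁ + k₃ * δu) / k₂) := by
  have key : ∀ M, max |d.transErr η φ.body (x 0) 0| ((k₁ + k₃ * δu) / k₂) < M →
      d.normErr η φ.body (x s) s ∈ Ioo (-1 : ℝ) 0 ∧ |d.transErr η φ.body (x s) s| ≤ M := by
    intro M hM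
    obtain ⟨h1, h2⟩ := h.normErr_mem_Icc hP hW hw hwW hη hd ht hu hk
      ((le_max_left _ _).trans_lt hM) ((le_max_right _ _).trans_lt hM) hs hsT
    have hξ : d.normErr η φ.body (x s) s ∈ Ioo (-1 : ℝ) 0 :=
      ⟨(neg_one_div_one_add_exp_mem _).1.trans_le h1,
        h2.trans_lt (neg_one_div_one_add_exp_mem _).2⟩
    exact ⟨hξ, abs_le.2 ⟨(le_log_neg_div_iff hξ _).2 h1, (log_neg_div_le_iff hξ _).2 h2⟩⟩
  exact ⟨(key _ (lt_add_one _)).1, le_of_forall_gt_imp_ge_of_dense fun M hM => (key M hM).2⟩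

end Funnel

/-! ### Maximal solutions, Zeno behaviour and satisfaction of the formula -/

section Maximal

variable {n m : ℕ} {P : Plant n m} {lam : ℝ} {W : Set (State n)} {w : ℝ → State n} {d : Design}
  {η : ℝ} {φ : Temporal n} {x₀ : State n} {t : ℕ → EReal} {x : ℝ → State n}
  {uhat : ℝ → Fin m → ℝ} {T : EReal} {u : State n → ℝ → Fin m → ℝ}

/-- A bounded maximal solution reaches every triggering instant. -/
lemma IsMaximalSolution.eq_iSup (hP : P.IsRegular lam) (hW : Bornology.IsBounded W)
    (hw : PiecewiseContinuous w) (hwW : ∀ s : ℝ, 0 ≤ s → w s ∈ W) (ht : IsTriggerSeq t)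
    (h : IsMaximalSolution P w u x₀ t x uhat T) {R : ℝ}
    (hR : ∀ s : ℝ, 0 ≤ s → (s : EReal) < T → ‖x s‖ ≤ R) : T = ⨆ i, t i := by
  have hsol := h.isSolution
  refine hsol.T_le.eq_of_not_lt fun hlt => ?_
  obtain ⟨b, rfl⟩ : ∃ b : ℝ, (b : EReal) = T :=
    ⟨T.toReal, EReal.coe_toReal (hlt.trans_le le_top).ne
      (EReal.bot_lt_zero.trans hsol.T_pos).ne'⟩
  have hb : 0 < b := by exact_mod_cast hsol.T_pos
  have hint : IntegrableOn (fun s => P.rhs (uhat s) (x s) + w s) (Ico 0 b) := by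
    refine integrableOn_dynamics hP hW hw hwW ht hlt
      (hsol.continuous_x.mono fun s hs => ⟨hs.1, by exact_mod_cast hs.2⟩)
      (fun s hs => hR s hs.1 (by exact_mod_cast hs.2))
      (fun i s hs h1 h2 => hsol.hold i s h1 h2 (by exact_mod_cast hs.2))
  -- This primitive equals the solution on [0, b) and supplies its limit at `b`, from which a
  -- continuation can start.
  set z : ℝ → State n := fun s => x₀ + ∫ σ in (0 : ℝ)..s, (P.rhs (uhat σ) (x σ) + w σ) with hz
  have hzx : ∀ s, 0 ≤ s → s < b → z s = x s := fun s hs0 hs =>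
    (hsol.eq_integral hs0 (by exact_mod_cast hs)).symm
  have hzc : ContinuousOn z (Icc 0 b) := by
    have hint' : IntegrableOn (fun s => P.rhs (uhat s) (x s) + w s) (uIcc 0 b) := by
      rw [uIcc_of_le hb.le]
      exact (integrableOn_Icc_iff_integrableOn_Ico (by finiteness)).2 hint
    have := intervalIntegral.continuousOn_primitive_interval hint'
    rw [uIcc_of_le hb.le] at this
    exact continuousOn_const.add this
  obtain ⟨x', u', T', hsol', hbT, hx'⟩ := exists_continuation (x := z) (uhat := uhat) (u := u)
    (x₀ := x₀) hP hW hw hwW ht hb.le hlt hzc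
    (fun i s h1 h2 hs => by
      obtain ⟨h3, h4⟩ := ht.toReal_mem h1
      rw [hzx _ h3 (h4.trans_lt hs)]
      exact hsol.hold i s h1 h2 (by exact_mod_cast hs))
    (fun s hs => by
      simp only [hz]
      congr 1
      refine intervalIntegral.integral_congr_Ioo_of_le hs.1 fun σ hσ => ?_
      have := hzx σ hσ.1.le (hσ.2.trans_le hs.2)
      simp only [hz] at this
      simp only [this])
  refine absurd (h.maximal x' u' T' hsol' fun s hs0 hs _ => ?_) (not_le.2 hbT)
  have hs' : s < b := by exact_mod_cast hs
  rw [hx' s ⟨hs0, hs'.le⟩, hzx s hs0 hs']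

/-- Joint continuity bounds the field uniformly over a compact set of inputs and states, even when
infinitely many input values occur. -/
lemma continuous_rhs_uncurry (hP : P.IsRegular lam) :
    Continuous fun p : (Fin m → ℝ) × State n => P.rhs p.1 p.2 :=
  (hP.lipschitz_f.continuous.comp continuous_snd).add
    ((PiLp.continuous_toLp 2 _).comp
      ((hP.continuous_g.comp continuous_snd).matrix_mulVec continuous_fst))

/-- Bounded solutions with bounded inputs are Lipschitz continuous. -/
lemma IsSolution.exists_norm_sub_le (hP : P.IsRegular lam) (hW : Bornology.IsBounded W)
    (hw : PiecewiseContinuous w) (hwW : ∀ s : ℝ, 0 ≤ s → w s ∈ W) (ht : IsTriggerSeq t)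
    (h : IsSolution P w u x₀ t x uhat T) {R U : ℝ}
    (hR : ∀ s : ℝ, 0 ≤ s → (s : EReal) < T → ‖x s‖ ≤ R)
    (hU : ∀ s : ℝ, 0 ≤ s → (s : EReal) < T → ‖uhat s‖ ≤ U) :
    ∃ K, ∀ a b : ℝ, 0 ≤ a → a ≤ b → (b : EReal) < T → ‖x b - x a‖ ≤ K * (b - a) := by
  obtain ⟨M, hM⟩ := ((isCompact_closedBall (0 : Fin m → ℝ) U).prod
    (isCompact_closedBall (0 : State n) R)).exists_bound_of_continuousOn
    (continuous_rhs_uncurry hP).continuousOn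
  obtain ⟨B, hB⟩ := hW.exists_norm_le
  refine ⟨M + B, fun a b ha hab hb => ?_⟩
  rw [h.sub_eq_integral hP hW hw hwW ht ha hab hb]
  have := intervalIntegral.norm_integral_le_of_norm_le_const (a := a) (b := b) (C := M + B)
    (f := fun s => P.rhs (uhat s) (x s) + w s) fun s hs => ?_
  · rwa [abs_of_nonneg (sub_nonneg.2 hab)] at this
  · rw [uIoc_of_le hab] at hs
    have hs0 := ha.trans hs.1.le
    have hsT : (s : EReal) < T := (EReal.coe_le_coe_iff.2 hs.2).trans_lt hb
    refine (norm_add_le _ _).trans (add_le_add (hM (uhat s, x s) ⟨?_, ?_⟩) (hB _ (hwW s hs0)))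
    · simpa using hU s hs0 hsT
    · simpa using hR s hs0 hsT

lemma norm_ofLp_le (v : State n) : ‖v.ofLp‖ ≤ ‖v‖ :=
  (pi_norm_le_iff_of_nonneg (norm_nonneg _)).2 fun i => PiLp.norm_apply_le v i

/-- The triggering rule excludes Zeno behaviour along Lipschitz continuous curves. -/
lemma ObeysRule.iSup_eq_top (ht : IsTriggerSeq t) {K : ℝ}
    (hK : ∀ a b : ℝ, 0 ≤ a → a ≤ b → (b : EReal) < T → ‖x b - x a‖ ≤ K * (b - a))
    {δ : ℕ → ℝ} (hδ : ∀ i, 0 < δ i) (hsum : ¬ Summable δ) (hrule : ObeysRule δ t x T) :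
    ⨆ i, t i = ⊤ := by
  by_contra hne
  have hlt : ⨆ i, t i < ⊤ := lt_top_iff_ne_top.2 hne
  have hti : ∀ i, t i ≠ ⊤ := fun i => ((le_iSup t i).trans_lt hlt).ne
  have hcoe : ∀ i, (((t i).toReal : ℝ) : EReal) = t i := fun i =>
    EReal.coe_toReal (hti i) (EReal.bot_lt_zero.trans_le (ht.nonneg i)).ne'
  -- A state event needs time at least δᵢ / K (for K > 0) and a clock event at least δᵢ, so δᵢ / L
  -- is below both.
  set L := max K 1 with hL
  have hL1 : 1 ≤ L := le_max_right _ _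
  have hL0 : 0 < L := by linarith
  have hstep : ∀ i, δ i / L ≤ (t (i + 1)).toReal - (t i).toReal := by
    intro i
    have h1 : (((t i).toReal + δ i / L : ℝ) : EReal) ≤ t (i + 1) := by
      rw [hrule i]
      refine le_sInf ?_
      rintro _ ⟨s, ⟨hs, hsT, hs'⟩, rfl⟩
      have h2 : (t i).toReal < s := by
        rw [← hcoe i] at hs
        exact_mod_cast hs
      have h3 : δ i ≤ L * (s - (t i).toReal) := by
        rcases hs' with hs' | hs'
        · have h4 := hK _ s (EReal.toReal_nonneg (ht.nonneg i)) h2.le hsT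
          have h5 : ‖(x s).ofLp - (x (t i).toReal).ofLp‖ ≤ ‖x s - x (t i).toReal‖ :=
            norm_ofLp_le (x s - x (t i).toReal)
          have h6 : K * (s - (t i).toReal) ≤ L * (s - (t i).toReal) :=
            mul_le_mul_of_nonneg_right (le_max_left _ _) (sub_nonneg.2 h2.le)
          linarith
        · nlinarith
      have h4 : δ i / L ≤ s - (t i).toReal := (div_le_iff₀' hL0).2 h3
      exact EReal.coe_le_coe_iff.2 (by linarith)
    rw [← hcoe (i + 1)] at h1
    have : (t i).toReal + δ i / L ≤ (t (i + 1)).toReal := by exact_mod_cast h1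
    linarith
  refine hsum ?_
  have hS : Summable fun i => δ i / L := by
    -- The gaps telescope, so a finite supremum of the instants would bound all partial sums.
    refine summable_of_sum_range_le (c := (⨆ i, t i).toReal)
      (fun i => (div_pos (hδ i) hL0).le) fun N => ?_
    calc ∑ i ∈ Finset.range N, δ i / L
        ≤ ∑ i ∈ Finset.range N, ((t (i + 1)).toReal - (t i).toReal) :=
          Finset.sum_le_sum fun i _ => hstep i
      _ = (t N).toReal := by
          rw [Finset.sum_range_sub fun i => (t i).toReal, ht.zero]
          simp
      _ ≤ (⨆ i, t i).toReal :=
          EReal.toReal_le_toReal (le_iSup t N)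
            (EReal.bot_lt_zero.trans_le (ht.nonneg N)).ne' hne
  simpa [div_mul_cancel₀ _ hL0.ne'] using hS.mul_right L

lemma TimeInterval.mem_window_zero {I : TimeInterval} {s : ℝ} :
    s ∈ I.window 0 ↔ I.a ≤ s ∧ (s : EReal) ≤ I.b := by
  simp [TimeInterval.window]

/-- A curve that stays in the funnel forever satisfies the formula with the desired robustness. -/
lemma Design.Admissible.rob_mem_of_normErr_mem (hη : 0 < η) (hd : d.Admissible η φ x₀)
    (h : ∀ s : ℝ, 0 ≤ s → d.normErr η φ.body (x s) s ∈ Ioo (-1 : ℝ) 0) :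
    (d.r : EReal) ≤ φ.rob η x 0 ∧ φ.rob η x 0 ≤ (d.ρmax : EReal) ∧ φ.Sat x 0 := by
  have hr := (NonTemporal.contDiff_robR hη hd.rob_ne_top).2
  have hup : ∀ s : ℝ, 0 ≤ s → φ.body.rob η (x s) ≤ (d.ρmax : EReal) := fun s hs => by
    rw [hr]
    exact_mod_cast (hd.normErr_mem_Ioo_iff.1 (h s hs)).2.le
  have hlow : ∀ s : ℝ, d.tStar ≤ s → (d.r : EReal) ≤ φ.body.rob η (x s) := fun s hs => by
    have h1 := (hd.normErr_mem_Ioo_iff.1 (h s (hd.tStar_mem.nonneg.trans hs))).1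
    have h2 := hd.perf_antitone hs
    have h3 := hd.perf_tStar_le
    rw [hr]
    exact_mod_cast (by linarith : d.r ≤ φ.body.robR η (x s))
  have hsat : ∀ s : ℝ, d.tStar ≤ s → φ.body.Sat (x s) := fun s hs =>
    NonTemporal.sat_of_rob_pos hη (lt_of_lt_of_le (by exact_mod_cast hd.r_pos) (hlow s hs))
  have ht := hd.tStar_mem
  cases φ with
  | always I ψ =>
    have ht' : d.tStar = I.a := ht
    rw [ht'] at hlow hsat
    refine ⟨le_iInf₂ fun s hs => hlow s (TimeInterval.mem_window_zero.1 hs).1, ?_,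
      fun s hs => hsat s (TimeInterval.mem_window_zero.1 hs).1⟩
    exact iInf₂_le_of_le I.a (TimeInterval.mem_window_zero.2 ⟨le_rfl, I.a_le_b⟩)
      (hup I.a I.a_nonneg)
  | eventually I ψ =>
    have hmem := TimeInterval.mem_window_zero.2 ht
    refine ⟨le_iSup₂_of_le d.tStar hmem (hlow _ le_rfl), ?_, d.tStar, hmem, hsat _ le_rfl⟩
    exact iSup₂_le fun s hs =>
      hup s (I.a_nonneg.trans (TimeInterval.mem_window_zero.1 hs).1)

end Maximal

end STLControl

end

open STLControl in
theorem theorem2 {n m : ℕ} (P : Plant n m) (lam : ℝ) (hP : P.IsRegular lam)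
    (W : Set (State n)) (hW : Bornology.IsBounded W)
    (w : ℝ → State n) (hw : PiecewiseContinuous w) (hwW : ∀ s : ℝ, 0 ≤ s → w s ∈ W)
    (η : ℝ) (hη : 0 < η) (φ : Temporal n)
    (hconc : ConcaveOn ℝ Set.univ (φ.body.robR η)) (hwell : φ.body.WellPosed η)
    (hopt : 0 < φ.body.robOpt η)
    (x₀ : State n) (d : Design) (hd : d.Admissible η φ x₀) :
    (∃ k₁ k₂ k₃ : ℝ, IsGain P lam W d η φ.body k₁ k₂ k₃) ∧
    ∀ t : ℕ → EReal, IsTriggerSeq t →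
      (∃ x uhat T, IsMaximalSolution P w (P.feedback d η φ.body) x₀ t x uhat T) ∧
      ∀ δu : ℝ, 0 < δu → ∀ (x : ℝ → State n) (uhat : ℝ → Fin m → ℝ) (T : EReal),
        IsSolution P w (P.feedback d η φ.body) x₀ t x uhat T →
        (∀ s : ℝ, 0 ≤ s → (s : EReal) < T → ‖P.feedback d η φ.body (x s) s - uhat s‖ ≤ δu) →
        (∀ s : ℝ, 0 ≤ s → (s : EReal) < T →
          d.normErr η φ.body (x s) s ∈ Set.Ioo (-1 : ℝ) 0 ∧
          ∀ k₁ k₂ k₃ : ℝ, IsGain P lam W d η φ.body k₁ k₂ k₃ →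
            |d.transErr η φ.body (x s) s|
              ≤ max |d.transErr η φ.body (x 0) 0| ((k₁ + k₃ * δu) / k₂)) ∧
        (IsMaximalSolution P w (P.feedback d η φ.body) x₀ t x uhat T →
          T = ⨆ i, t i ∧
          (∀ δ : ℕ → ℝ, (∀ i, 0 < δ i) → ¬ Summable δ → ObeysRule δ t x T →
            ⨆ i, t i = ⊤) ∧
          ((⨆ i, t i) = ⊤ →
            T = ⊤ ∧ 0 < d.r ∧ (d.r : EReal) ≤ φ.rob η x 0 ∧ φ.rob η x 0 ≤ (d.ρmax : EReal) ∧
              φ.Sat x 0)) := by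
  obtain ⟨k₁, k₂, k₃, hk⟩ := exists_isGain hP hW hη hconc hwell hd
  refine ⟨⟨k₁, k₂, k₃, hk⟩, fun t ht => ⟨exists_isMaximalSolution hP hW hw hwW ht _ x₀, ?_⟩⟩
  intro δu _ x uhat T hsol hu
  have hfun := fun (s : ℝ) (hs : 0 ≤ s) (hsT : (s : EReal) < T) =>
    hsol.normErr_mem_and_abs_transErr_le hP hW hw hwW hη hd ht hu hk hs hsT
  refine ⟨fun s hs hsT => ⟨(hfun s hs hsT).1, fun k₁' k₂' k₃' hk' =>
    (hsol.normErr_mem_and_abs_transErr_le hP hW hw hwW hη hd ht hu hk' hs hsT).2⟩, fun hmax => ?_⟩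
  obtain ⟨R, hR⟩ := hd.exists_norm_le_of_mem_stateSet hη hconc hwell
  have hΩ := fun (s : ℝ) (hs : 0 ≤ s) (hsT : (s : EReal) < T) =>
    hd.mem_stateSet_of_normErr hs (hfun s hs hsT).1
  have hxR := fun (s : ℝ) (hs : 0 ≤ s) (hsT : (s : EReal) < T) => hR _ (hΩ s hs hsT)
  have hT := hmax.eq_iSup hP hW hw hwW ht hxR
  refine ⟨hT, fun δ hδ hsum hrule => ?_, fun htop => ?_⟩
  · set E := max |d.transErr η φ.body (x 0) 0| ((k₁ + k₃ * δu) / k₂)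
    have hU : ∀ s : ℝ, 0 ≤ s → (s : EReal) < T → ‖uhat s‖ ≤ E * k₃ + δu := by
      intro s hs hsT
      -- The maximum norm is at most the sum norm bounded by k₃. With the bound `E` on ε this bounds
      -- u, and û differs from u by at most δ_u.
      have h1 : ‖P.inputGrad η φ.body (x s)‖ ≤ k₃ := by
        refine (pi_norm_le_iff_of_nonneg hk.k₃_pos.le).2 fun j => ?_
        exact (Finset.single_le_sum (f := fun j => |P.inputGrad η φ.body (x s) j|)
          (fun _ _ => abs_nonneg _) (Finset.mem_univ j)).trans (hk.input _ (hΩ s hs hsT))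
      have h2 : ‖P.feedback d η φ.body (x s) s‖ ≤ E * k₃ := by
        rw [Plant.feedback, norm_smul, norm_neg, Real.norm_eq_abs]
        exact mul_le_mul (hfun s hs hsT).2 h1 (norm_nonneg _)
          ((abs_nonneg _).trans (hfun s hs hsT).2)
      calc ‖uhat s‖
          = ‖P.feedback d η φ.body (x s) s - (P.feedback d η φ.body (x s) s - uhat s)‖ := by
            rw [sub_sub_cancel]
        _ ≤ E * k₃ + δu := (norm_sub_le _ _).trans (add_le_add h2 (hu s hs hsT))
    obtain ⟨K, hK⟩ := hsol.exists_norm_sub_le hP hW hw hwW ht hxR hU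
    exact ObeysRule.iSup_eq_top ht hK hδ hsum hrule
  · have hTtop : T = ⊤ := hT.trans htop
    exact ⟨hTtop, hd.r_pos, hd.rob_mem_of_normErr_mem hη fun s hs =>
      (hfun s hs (hTtop ▸ EReal.coe_lt_top s)).1⟩
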